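/- Let $a<b$ be coprime positive integers. An $a,b$-Dyck path is a lattice path with unit north and east steps from $(0,0)$ to $(b,a)$ that stays weakly above the line $y=\frac{a}{b}x$. Given such a path $D$, place the label $k$ slightly below the east end of the $k$-th east step of $D$, for $k=1,\dots,b-1$. A valley of $D$ is a lattice point on $D$ immediately preceded by an east step and immediately followed by a north step. From each valley of $D$ fire a laser: the line segment of slope $\frac{a}{b}$ that goes northeast from the valley until it first meets $D$ again (by coprimality, in the interior of an east step). Let $\pi(D)$ be the set partition of $[b-1]=\{1,\dots,b-1\}$ in which $k\sim l$ if and only if no laser separates the labels $k$ and $l$ below $D$; explicitly, a laser fired from a valley with $x$-coordinate $i$ and ending in the interior of the east step from $x=j$ to $x=j+1$ separates the labels in $\{i+1,\dots,j\}$ from all other labels. Let $\mathsf{NC}(a,b)=\{\pi(D): D \text{ an } a,b\text{-Dyck path}\}$ be the set of $a,b$-noncrossing partitions, and let $\mathtt{rot}$ be the operator on set partitions of $[b-1]$ induced by the cyclic permutation $1\mapsto 2\mapsto\cdots\mapsto b-1\mapsto 1$. Let $d$ be a divisor of $b-1$ with $1\le d<b-1$. Then the number of partitions $\pi\in\mathsf{NC}(a,b)$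 with $\mathtt{rot}^d(\pi)=\pi$ is $$\binom{\left\lfloor \frac{ad}{b-1}\right\rfloor+d}{d}.$$ -/

import Mathlib

namespace RationalNC

/-- A unit step of a lattice path: `N` is the north step, `E` is the east step. -/
inductive Step where
  | N : Step
  | E : Step
  deriving DecidableEq

open Step

/-- `IsDyckPath a b w`: the word `w`, read as a lattice path starting at `(0, 0)`, is an
`a,b`-Dyck path. It ends at `(b, a)`, and each lattice point `(x, y)` on it (the end of an initial
subpath `u`) satisfies `a * x ≤ b * y`, so the path stays above the line `y = (a / b) x`. -/
def IsDyckPath (a b : ℕ) (w : List Step) : Prop :=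
  w.count N = a ∧ w.count E = b ∧
    ∀ u : List Step, u <+: w → a * u.count E ≤ b * u.count N

/-- `w` has an east step from the lattice point `(x, y)` to `(x + 1, y)`. -/
def HasEastStep (w : List Step) (x y : ℕ) : Prop :=
  ∃ u v : List Step, w = u ++ E :: v ∧ u.count E = x ∧ u.count N = y

/-- `(x, y)` is a valley of `w`: a lattice point on `w` which is immediately preceded by an east
step and immediately followed by a north step. -/
def HasValley (w : List Step) (x y : ℕ) : Prop :=
  ∃ u v : List Step, w = u ++ E :: N :: v ∧ (u ++ [E]).count E = x ∧ (u ++ [E]).count N = y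

/-- The height over the abscissa `x` of the line of slope `a / b` through `(i, h)`. -/
def lineHeight (a b i h : ℕ) (x : ℚ) : ℚ := h + (a / b : ℚ) * (x - i)

/-- The ray of slope `a / b` fired northeast from `(i, h)` passes through the interior of an east
step of `w` with west endpoint `(j, y)`, for some `y`. -/
def RayCrosses (a b : ℕ) (w : List Step) (i h j : ℕ) : Prop :=
  i ≤ j ∧ ∃ y : ℕ, HasEastStep w j y ∧
    lineHeight a b i h j < y ∧ (y : ℚ) < lineHeight a b i h (j + 1)

/-- The laser set of `w`: the pairs `(i, j)` such that the laser of slope `a / b` fired from a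
valley with `x`-coordinate `i` first meets `w` again in the interior of the east step whose west
endpoint has `x`-coordinate `j`. (On a Dyck path with `a`, `b` coprime a laser travels below the
path until it stops, and so it can meet the path only from below, in the interior of an
east step.) -/
def laserSet (a b : ℕ) (w : List Step) : Set (ℕ × ℕ) :=
  {p | ∃ h : ℕ, HasValley w p.1 h ∧ RayCrosses a b w p.1 h p.2 ∧
    ∀ j' < p.2, ¬ RayCrosses a b w p.1 h j'}

/-- The element `k` of `Fin n` stands for the label `k + 1` of `[n] = {1, …, n}`. -/
def label {n : ℕ} (k : Fin n) : ℕ := k + 1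

/-- The label `k` sits slightly below the east end of the `k`-th east step, which has
`x`-coordinate `k`. The laser `(i, j)` passes between that label and the ground exactly when
`i < k ≤ j`: it starts at `x = i` above the label `i`, and ends at some `x` with `j < x < j + 1`. -/
def LaserCutsOff (p : ℕ × ℕ) (k : ℕ) : Prop := p.1 < k ∧ k ≤ p.2

/-- The set partition `π(w)` of `[b - 1]`, as an equivalence relation: two labels are equivalent
iff no laser of `w` separates them, that is, cuts off exactly one of the two. -/
def partitionOf (a b : ℕ) (w : List Step) : Setoid (Fin (b - 1)) where
  r k l := ∀ p ∈ laserSet a b w, (LaserCutsOff p (label k) ↔ LaserCutsOff p (label l))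
  iseqv :=
    ⟨fun _ _ _ => Iff.rfl, fun h p hp => (h p hp).symm,
      fun h₁ h₂ p hp => (h₁ p hp).trans (h₂ p hp)⟩

/-- The set of `a,b`-noncrossing partitions of `[b - 1]`. -/
def NC (a b : ℕ) : Set (Setoid (Fin (b - 1))) :=
  {π | ∃ w : List Step, IsDyckPath a b w ∧ partitionOf a b w = π}

/-- Rotation of set partitions of `[n]`, induced by the permutation `1 ↦ 2 ↦ ⋯ ↦ n ↦ 1`: the
blocks of `rot π` are the images under it of the blocks of `π`. -/
def rot {n : ℕ} (π : Setoid (Fin n)) : Setoid (Fin n) :=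
  Setoid.comap (finRotate n).symm π

end RationalNC

namespace RationalNC

/-! Measured vertically from the line of slope `a / b` and scaled by `b`, a Dyck path becomes a walk
`W` with steps `-a + b * r`, zero at both ends and positive between. A laser becomes a horizontal
level held until the walk first drops below it, so two labels lie in one block exactly when they
have the same predecessor, the last earlier index with value at most the current one
(`partitionOf_iff`).

Extend the partition to `ℤ` with period `b - 1`, and let the rank of a block be the rise `r` at its
leftmost element. The path can be cut at any other point of the line without changing blocks or
ranks (`Realizes.exists_succ`), and the partition determines the walk and hence the ranks
(`Realizes.eq_walk`). So a rotation that fixes the partition also preserves the ranks.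

Let the partition be invariant under translation by `d`, with `b - 1 = q * d` and `q ≥ 2`. A class
either has first elements, preceded by a gap longer than `d`, or is the single central class with no
such gap. Recording the ranks at first elements and `0` elsewhere gives a `d`-periodic sequence. The
ranks of all blocks in a period add up to `a`, so the sum of the sequence over `d` terms, taken `q`
times, is at most `a` (`sum_le`). The partition is recovered from the bi-infinite walk `V` with
steps `b * s k - a`: classes with a first element are told apart by their predecessor modulo `b -
1`, and the central class has no predecessor (`rel_iff_code`). Conversely every such sequence
occurs, the deficit `z` being the rank of the central class (`isInvariant_code`, `isFirst_code`). It
remains to count `d`-tuples with sum at most `a / q`, by stars and bars. -/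

/-! ### Predecessors and walks. -/

/-- `m` is the last index before `k` at which the value of `V` is at most `V k`. -/
def IsPrev (V : ℤ → ℤ) (k m : ℤ) : Prop :=
  m < k ∧ V m ≤ V k ∧ ∀ i, m < i → i < k → V k < V i

theorem IsPrev.le_of_le {V : ℤ → ℤ} {k m i : ℤ} (h : IsPrev V k m) (hi : i < k)
    (hV : V i ≤ V k) : i ≤ m := by
  by_contra! hlt
  exact absurd (h.2.2 i hlt hi) (not_lt.2 hV)

theorem IsPrev.unique {V : ℤ → ℤ} {k m m' : ℤ} (h : IsPrev V k m) (h' : IsPrev V k m') :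
    m = m' :=
  le_antisymm (h'.le_of_le h.1 h.2.1) (h.le_of_le h'.1 h'.2.1)

/-- Thus `m + 1` is the leftmost index among those with predecessor `m`, and it can serve as the
representative of their block. -/
theorem IsPrev.self_succ {V : ℤ → ℤ} {k m : ℤ} (h : IsPrev V k m) : IsPrev V (m + 1) m := by
  refine ⟨by omega, ?_, fun i h1 h2 => by omega⟩
  rcases eq_or_lt_of_le (show m + 1 ≤ k by have := h.1; omega) with heq | hlt
  · rw [heq]; exact h.2.1
  · exact h.2.1.trans (h.2.2 _ (by omega) hlt).le

theorem exists_isPrev {V : ℤ → ℤ} {c k : ℤ} (hc : c < k) (hV : V c ≤ V k) :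
    ∃ m, c ≤ m ∧ IsPrev V k m := by
  obtain ⟨m, ⟨hm1, hm2⟩, hm⟩ := Int.exists_greatest_of_bdd
    (P := fun m => m < k ∧ V m ≤ V k) ⟨k, fun z hz => hz.1.le⟩ ⟨c, hc, hV⟩
  refine ⟨m, hm c ⟨hc, hV⟩, hm1, hm2, fun i h1 h2 => ?_⟩
  by_contra! h
  have := hm i ⟨h2, h⟩
  omega

theorem IsPrev.congr {V V' : ℤ → ℤ} {k m e : ℤ} (h : IsPrev V k m)
    (hV : ∀ i, m ≤ i → i ≤ k → V' i = V i + e) : IsPrev V' k m := by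
  obtain ⟨h1, h2, h3⟩ := h
  refine ⟨h1, ?_, fun i hi1 hi2 => ?_⟩
  · rw [hV m le_rfl h1.le, hV k h1.le le_rfl]; omega
  · have := h3 i hi1 hi2
    rw [hV i hi1.le hi2.le, hV k h1.le le_rfl]; omega

theorem IsPrev.shift {V V' : ℤ → ℤ} {k m e t : ℤ} (h : IsPrev V k m)
    (hV : ∀ i, V' (i + t) = V i + e) : IsPrev V' (k + t) (m + t) := by
  obtain ⟨h1, h2, h3⟩ := h
  refine ⟨by omega, ?_, fun i hi1 hi2 => ?_⟩
  · rw [hV, hV]; omega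
  · have h4 := h3 (i - t) (by omega) (by omega)
    have h5 := hV (i - t)
    rw [sub_add_cancel] at h5
    rw [h5, hV]; omega

/-- The walk of an `a,b`-Dyck path read from the abscissa `c`: at `c + k` it is `b` times the height
of the `k`-th east step above the line of slope `a / b`. -/
structure IsWalk (a b c : ℤ) (W : ℤ → ℤ) : Prop where
  start : W c = 0
  finish : W (c + b) = 0
  pos : ∀ k, c < k → k < c + b → 0 < W k
  step : ∀ k, c < k → k ≤ c + b → ∃ r : ℕ, W k = W (k - 1) - a + b * r

namespace IsWalk

variable {a b c : ℤ} {W : ℤ → ℤ}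

theorem nonneg (hW : IsWalk a b c W) {k : ℤ} (h1 : c ≤ k) (h2 : k ≤ c + b) : 0 ≤ W k := by
  rcases eq_or_lt_of_le h1 with rfl | h1
  · exact hW.start.ge
  rcases eq_or_lt_of_le h2 with rfl | h2
  · exact hW.finish.ge
  exact (hW.pos k h1 h2).le

theorem sub_le (hW : IsWalk a b c W) (hb : 0 < b) {k : ℤ} (h1 : c < k) (h2 : k ≤ c + b) :
    W (k - 1) - a ≤ W k := by
  obtain ⟨r, hr⟩ := hW.step k h1 h2
  have : 0 ≤ b * (r : ℤ) := by positivity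
  omega

/-- A step with `r ≥ 1` gains at least `b - a > 0`, so a falling step has `r = 0`. -/
theorem eq_sub_of_lt (hW : IsWalk a b c W) (hab : a < b) (hb : 0 < b) {k : ℤ} (h1 : c < k)
    (h2 : k ≤ c + b) (h : W k < W (k - 1)) : W k = W (k - 1) - a := by
  obtain ⟨r, hr⟩ := hW.step k h1 h2
  rcases Nat.eq_zero_or_pos r with rfl | hr0
  · simpa using hr
  · have : b * 1 ≤ b * (r : ℤ) := by gcongr; exact_mod_cast hr0
    omega

theorem lt_of_le (hW : IsWalk a b c W) (ha : 0 < a) (hab : a < b) {k : ℤ} (h1 : c < k)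
    (h2 : k ≤ c + b) (h : W (k - 1) ≤ W k) : W (k - 1) < W k := by
  have hb : 0 < b := ha.trans hab
  obtain ⟨r, hr⟩ := hW.step k h1 h2
  rcases Nat.eq_zero_or_pos r with rfl | hr0
  · simp at hr; omega
  · have : b * 1 ≤ b * (r : ℤ) := by gcongr; exact_mod_cast hr0
    omega

theorem last (hW : IsWalk a b c W) (hab : a < b) (ha : 0 < a) (hb : 1 < b) :
    W (c + b - 1) = a := by
  have h1 := hW.eq_sub_of_lt hab (by omega) (k := c + b) (by omega) le_rfl
    (by rw [hW.finish]; exact hW.pos _ (by omega) (by omega))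
  rw [hW.finish] at h1
  omega

theorem exists_isPrev (hW : IsWalk a b c W) {k : ℤ} (h1 : c < k) (h2 : k ≤ c + b) :
    ∃ m, c ≤ m ∧ IsPrev W k m :=
  RationalNC.exists_isPrev h1 (by rw [hW.start]; exact hW.nonneg h1.le h2)

theorem isPrev_start (hW : IsWalk a b c W) (hb : 0 < b) : IsPrev W (c + 1) c :=
  ⟨by omega, by rw [hW.start]; exact hW.nonneg (by omega) (by omega), fun i _ _ => by omega⟩

theorem isPrev_finish (hW : IsWalk a b c W) (hb : 0 < b) : IsPrev W (c + b) c :=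
  ⟨by omega, by rw [hW.start, hW.finish], fun i h1 h2 => by rw [hW.finish]; exact hW.pos i h1 h2⟩

/-- Every step is `-a` modulo `b`. This residue pins down a value already known up to an error
smaller than `b`. -/
theorem modEq (hW : IsWalk a b c W) {k : ℤ} (h1 : c ≤ k) (h2 : k ≤ c + b) :
    b ∣ W k + a * (k - c) := by
  induction k, h1 using Int.leInduction with
  | base => simp [hW.start]
  | succ k hk ih =>
    obtain ⟨r, hr⟩ := hW.step (k + 1) (by omega) h2
    obtain ⟨e, he⟩ := ih (by omega)
    refine ⟨e + r, ?_⟩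
    rw [add_sub_cancel_right] at hr
    rw [hr]; linear_combination he

theorem congr (hW : IsWalk a b c W) {W' : ℤ → ℤ} {t : ℤ} (hb : 0 < b)
    (h : ∀ k, c ≤ k → k ≤ c + b → W' (k + t) = W k) : IsWalk a b (c + t) W' where
  start := by rw [h c le_rfl (by omega), hW.start]
  finish := by rw [add_right_comm, h _ (by omega) le_rfl, hW.finish]
  pos k h1 h2 := by
    have := h (k - t) (by omega) (by omega)
    rw [sub_add_cancel] at this
    rw [this]; exact hW.pos _ (by omega) (by omega)
  step k h1 h2 := by
    have h3 := h (k - t) (by omega) (by omega)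
    have h4 := h (k - t - 1) (by omega) (by omega)
    rw [sub_add_cancel] at h3
    rw [show k - t - 1 + t = k - 1 by ring] at h4
    rw [h3, h4]; exact hW.step _ (by omega) (by omega)

end IsWalk

/-! ### Walks that realize a periodic partition. -/

/-- The walk `W` on `[c, c + b]` has the classes of `R` as its blocks between `c` and `c + b`, and
`ρ k` is the rank of the block that starts at `k`. -/
structure Realizes (a b : ℤ) (R : Setoid ℤ) (ρ : ℤ → ℕ) (c : ℤ) (W : ℤ → ℤ) : Prop where
  walk : IsWalk a b c W
  rel : ∀ k l, c < k → k < c + b → c < l → l < c + b →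
    (R k l ↔ ∃ m, IsPrev W k m ∧ IsPrev W l m ∧ c ≤ m)
  rank : ∀ k, c < k → k < c + b → W (k - 1) ≤ W k → W k = W (k - 1) - a + b * ρ k

/-- A cyclic `a,b`-noncrossing partition `R` of `ℤ` with period `b - 1`, with rank function `ρ`. -/
structure IsRanked (a b : ℤ) (R : Setoid ℤ) (ρ : ℤ → ℕ) : Prop where
  periodic : ∀ k, R k (k + (b - 1))
  const : ∀ k l, R k l → ρ k = ρ l

namespace Realizes

variable {a b c : ℤ} {W : ℤ → ℤ} {R : Setoid ℤ} {ρ : ℤ → ℕ}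

/-- The right end `c + b` has predecessor `c`, just like `c + 1`, of which it is the translate by
the period `b - 1`. -/
theorem rel_le (h : Realizes a b R ρ c W) (hR : IsRanked a b R ρ) (hb : 1 < b) {k l : ℤ}
    (h1 : c < k) (h2 : k ≤ c + b) (h3 : c < l) (h4 : l ≤ c + b) :
    R k l ↔ ∃ m, IsPrev W k m ∧ IsPrev W l m ∧ c ≤ m := by
  have hs := h.walk.isPrev_start (by omega)
  have ht := h.walk.isPrev_finish (by omega)
  have hp : R (c + 1) (c + b) := by
    have := hR.periodic (c + 1)
    rwa [show c + 1 + (b - 1) = c + b by ring] at this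
  have key : ∀ k, c < k → k ≤ c + b → ∃ k', c < k' ∧ k' < c + b ∧ R k k' ∧
      ∀ m, IsPrev W k m ↔ IsPrev W k' m := by
    intro k h1 h2
    rcases eq_or_lt_of_le h2 with rfl | h2
    · refine ⟨c + 1, by omega, by omega, R.symm hp, fun m => ⟨fun hm => ?_, fun hm => ?_⟩⟩
      · rwa [hm.unique ht]
      · rwa [hm.unique hs]
    · exact ⟨k, h1, h2, R.refl k, fun m => Iff.rfl⟩
  obtain ⟨k', a1, a2, a3, a4⟩ := key k h1 h2
  obtain ⟨l', b1, b2, b3, b4⟩ := key l h3 h4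
  simp only [a4, b4]
  rw [← h.rel k' l' a1 a2 b1 b2]
  exact ⟨fun hh => R.trans (R.trans (R.symm a3) hh) b3,
    fun hh => R.trans (R.trans a3 hh) (R.symm b3)⟩

theorem rel_isPrev (h : Realizes a b R ρ c W) (hR : IsRanked a b R ρ) (hb : 1 < b) {k m : ℤ}
    (hm : c ≤ m) (h2 : k ≤ c + b) (hk : IsPrev W k m) : R (m + 1) k := by
  have := hk.1
  exact (h.rel_le hR hb (by omega) (by omega) (by omega) h2).2 ⟨m, hk.self_succ, hk, hm⟩

theorem lt_of_rel (h : Realizes a b R ρ c W) (hR : IsRanked a b R ρ) (hb : 1 < b) {k l : ℤ}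
    (h1 : c < k) (hkl : k < l) (h2 : l ≤ c + b) (hr : R k l) {i : ℤ} (h3 : k ≤ i) (h4 : i < l) :
    W l < W i := by
  obtain ⟨m, hk, hl, -⟩ := (h.rel_le hR hb h1 (by omega) (by omega) h2).1 hr
  exact hl.2.2 i (lt_of_lt_of_le hk.1 h3) h4

/-- Let `m`, `m'` be the predecessors shared by `i, k` and by `j, l`. The order of the indices
forces `m ≤ m'`, and `m < m'` would give `W k < W m' ≤ W l < W k`. -/
theorem noncrossing (h : Realizes a b R ρ c W) (hR : IsRanked a b R ρ) (hb : 1 < b)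
    {i j k l : ℤ} (h0 : c < i) (hij : i < j) (hjk : j < k) (hkl : k < l) (hl : l ≤ c + b)
    (hik : R i k) (hjl : R j l) : R i j := by
  obtain ⟨m, hi, hk, hm⟩ := (h.rel_le hR hb h0 (by omega) (by omega) (by omega)).1 hik
  obtain ⟨m', hj, hl', hm'⟩ := (h.rel_le hR hb (by omega) (by omega) (by omega) hl).1 hjl
  have h1 : W k < W j := hk.2.2 j (by have := hi.1; omega) hjk
  have h2 : W l < W k := hl'.2.2 k (by have := hj.1; omega) hkl
  have h3 : m ≤ m' := hj.le_of_le (by have := hi.1; omega) (hk.2.1.trans h1.le)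
  rcases eq_or_lt_of_le h3 with rfl | h3
  · exact (h.rel_le hR hb h0 (by omega) (by omega) (by omega)).2 ⟨m, hi, hj, hm⟩
  · have h4 := hk.2.2 m' h3 (by have := hj.1; omega)
    have h5 := hl'.2.1
    omega

/-- If the predecessor of `k` is `m`, then `m + 1` lies in the block of `k`. Hence `k` opens its
block in the window exactly when `m = k - 1`, that is, at a rise. -/
theorem le_sub_one_iff (h : Realizes a b R ρ c W) (hR : IsRanked a b R ρ) (hb : 1 < b) {k : ℤ}
    (h1 : c < k) (h2 : k ≤ c + b) : W (k - 1) ≤ W k ↔ ∀ i, c < i → i < k → ¬ R i k := by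
  constructor
  · intro hle i hi hik hr
    have := h.lt_of_rel hR hb hi hik h2 hr (i := k - 1) (by omega) (by omega)
    omega
  · intro hno
    obtain ⟨m, hm, hk⟩ := h.walk.exists_isPrev h1 h2
    have h3 := h.rel_isPrev hR hb hm h2 hk
    rcases eq_or_lt_of_le (show m + 1 ≤ k by have := hk.1; omega) with heq | hlt
    · have := hk.2.1
      rwa [show k - 1 = m by omega]
    · exact absurd h3 (hno _ (by omega) hlt)

/-- The increments of a walk in terms of the classes and ranks. -/
theorem step_eq (h : Realizes a b R ρ c W) (hR : IsRanked a b R ρ) (ha : 0 < a) (hab : a < b)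
    {k : ℤ} (h1 : c < k) (h2 : k < c + b) :
    ((∀ i, c < i → i < k → ¬ R i k) ∧ W k = W (k - 1) - a + b * ρ k) ∨
      ((∃ i, c < i ∧ i < k ∧ R i k) ∧ W k = W (k - 1) - a) := by
  by_cases hle : W (k - 1) ≤ W k
  · exact Or.inl ⟨(h.le_sub_one_iff hR (by omega) h1 h2.le).1 hle, h.rank k h1 h2 hle⟩
  · refine Or.inr ⟨?_, h.walk.eq_sub_of_lt hab (by omega) h1 h2.le (not_le.1 hle)⟩
    have := mt (h.le_sub_one_iff hR (by omega) h1 h2.le).2 hle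
    push Not at this
    obtain ⟨i, hi1, hi2, hi3⟩ := this
    exact ⟨i, hi1, hi2, hi3⟩

theorem rank_start (h : Realizes a b R ρ c W) (hb : 1 < b) : W (c + 1) = b * ρ (c + 1) - a := by
  have h1 := h.rank (c + 1) (by omega) (by omega)
    (by rw [add_sub_cancel_right, h.walk.start]; exact h.walk.nonneg (by omega) (by omega))
  rw [add_sub_cancel_right, h.walk.start] at h1
  omega

end Realizes

theorem IsWalk.ne {a b c : ℤ} {W : ℤ → ℤ} (hW : IsWalk a b c W) (hcop : IsCoprime a b) {i j : ℤ}
    (h1 : c ≤ i) (hij : i < j) (h2 : j < c + b) : W i ≠ W j := by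
  intro heq
  have hi := hW.modEq h1 (by omega)
  have hj := hW.modEq (k := j) (by omega) (by omega)
  have hd : b ∣ a * (j - i) := by
    have := dvd_sub hj hi
    rwa [heq, show W j + a * (j - c) - (W j + a * (i - c)) = a * (j - i) by ring] at this
  have := Int.le_of_dvd (by omega) (hcop.symm.dvd_of_dvd_mul_left hd)
  omega

/-! ### Moving the cut, and uniqueness of the walk. -/

namespace Realizes

variable {a b c : ℤ} {W : ℤ → ℤ} {R : Setoid ℤ} {ρ : ℤ → ℕ}

/-- Moving the cut one step to the right. -/
theorem exists_succ (h : Realizes a b R ρ c W) (hR : IsRanked a b R ρ) (ha : 0 < a) (hab : a < b)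
    (hb : 2 < b) (hcop : IsCoprime a b) : ∃ W', Realizes a b R ρ (c + 1) W' := by
  have hw := h.walk
  -- `x` is the next element of the block of `c + 1`; it may be `c + b`, the periodic copy of `c +
  -- 1` itself.
  obtain ⟨x, ⟨hx1, hx2⟩, hx3⟩ := Int.exists_least_of_bdd
    (P := fun k => c + 1 < k ∧ W k < W (c + 1)) ⟨c + 1, fun z hz => hz.1.le⟩
    ⟨c + b, by omega, by rw [hw.finish]; exact hw.pos _ (by omega) (by omega)⟩
  have hxb : x ≤ c + b :=
    hx3 (c + b) ⟨by omega, by rw [hw.finish]; exact hw.pos _ (by omega) (by omega)⟩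
  have hlow : ∀ i, c + 1 ≤ i → i < x → W (c + 1) ≤ W i := by
    intro i h1 h2
    by_contra! hlt
    rcases eq_or_lt_of_le h1 with rfl | h1
    · omega
    · have := hx3 i ⟨h1, hlt⟩
      omega
  have hxx : W x = W (x - 1) - a :=
    hw.eq_sub_of_lt hab (by omega) (by omega) hxb
      (hx2.trans_le (hlow _ (by omega) (by omega)))
  have hxp : IsPrev W x c := by
    refine ⟨by omega, by rw [hw.start]; exact hw.nonneg (by omega) hxb, fun i h1 h2 => ?_⟩
    exact hx2.trans_le (hlow i (by omega) h2)
  have hrx : R (c + 1) x := h.rel_isPrev hR (by omega) le_rfl hxb hxp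
  have hst := h.rank_start (by omega)
  -- Lowering by `W (c + 1)` before `x` and raising by `a` from `x` on makes the step into `x` equal
  -- to `W (c + 1) = b * ρ (c + 1) - a`: the opening rise of the block moves from `c + 1` to `x`.
  -- The value at `c + b` becomes `a`, ready for the final fall to `0`.
  set W' : ℤ → ℤ := fun y => if y < x then W y - W (c + 1) else if y ≤ c + b then W y + a else 0
    with hW'
  have e1 : ∀ y, y < x → W' y = W y - W (c + 1) := fun y hy => by simp [hW', hy]
  have e2 : ∀ y, x ≤ y → y ≤ c + b → W' y = W y + a := fun y hy hy' => by
    simp [hW', not_lt.2 hy, hy']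
  have e3 : W' (c + 1 + b) = 0 := by
    simp only [hW']; rw [if_neg (by omega), if_neg (by omega)]
  -- Predecessors other than `c` survive, and `c` is replaced by `x - 1`. Since `x - 1` was not a
  -- predecessor before, no two classes merge.
  have p1 : ∀ k m, k ≤ c + b → c < m → IsPrev W k m → IsPrev W' k m := by
    intro k m hk hm hp
    have hmk := hp.1
    by_cases hkx : k < x
    · exact hp.congr (e := - W (c + 1)) fun i _ _ => by rw [e1 i (by omega)]; ring
    by_cases hmx : x ≤ m
    · exact hp.congr (e := a) fun i _ _ => by rw [e2 i (by omega) (by omega)]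
    exfalso
    rcases eq_or_lt_of_le (not_lt.1 hkx) with rfl | hlt
    · have := hp.unique hxp
      omega
    · have h1 := hp.2.2 x (by omega) hlt
      have h2 := hxp.2.2 m hm (by omega)
      have h3 := hp.2.1
      omega
  have p2 : ∀ k, c + 1 < k → k ≤ c + b → IsPrev W k c → IsPrev W' k (x - 1) := by
    intro k hk1 hk hp
    have hkx : x ≤ k := hx3 k ⟨hk1, hp.2.2 _ (by omega) hk1⟩
    have hk0 := hw.nonneg (k := k) (by omega) hk
    refine ⟨by omega, ?_, fun i h1 h2 => ?_⟩
    · rw [e1 _ (by omega), e2 _ hkx hk]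
      omega
    · rw [e2 k hkx hk, e2 i (by omega) (by omega)]
      have := hp.2.2 i (by omega) h2
      omega
  have p3 : ∀ l, c + 1 < l → l ≤ c + b → ¬ IsPrev W l (x - 1) := by
    intro l _ hl hp
    rcases eq_or_lt_of_le (show x ≤ l by have := hp.1; omega) with rfl | hlt
    · have := hp.unique hxp
      omega
    · have h1 := hp.2.2 x (by omega) hlt
      have h3 := hp.2.1
      omega
  refine ⟨W', ⟨?_, e3, ?_, ?_⟩, ?_, ?_⟩
  · rw [e1 _ hx1, sub_self]
  · intro k h1 h2
    by_cases hkx : k < x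
    · rw [e1 k hkx]
      have h3 := hlow k (by omega) hkx
      have h4 := hw.ne hcop (i := c + 1) (j := k) (by omega) (by omega) (by omega)
      omega
    · rw [e2 k (by omega) (by omega)]
      have := hw.nonneg (k := k) (by omega) (by omega)
      omega
  · intro k h1 h2
    rcases lt_trichotomy k x with hkx | rfl | hkx
    · rw [e1 k hkx, e1 (k - 1) (by omega)]
      obtain ⟨r, hr⟩ := hw.step k (by omega) (by omega)
      exact ⟨r, by omega⟩
    · rw [e2 k le_rfl hxb, e1 (k - 1) (by omega)]
      exact ⟨ρ (c + 1), by omega⟩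
    · rw [e2 (k - 1) (by omega) (by omega)]
      rcases eq_or_lt_of_le h2 with rfl | h2
      · rw [e3]
        refine ⟨0, ?_⟩
        rw [show c + 1 + b - 1 = c + b by ring, hw.finish]; simp
      · rw [e2 k (by omega) (by omega)]
        obtain ⟨r, hr⟩ := hw.step k (by omega) (by omega)
        exact ⟨r, by omega⟩
  · intro k l hk1 hk2 hl1 hl2
    rw [h.rel_le hR (by omega) (by omega) (by omega) (by omega) (by omega)]
    constructor
    · rintro ⟨m, hk, hl, hm⟩
      rcases eq_or_lt_of_le hm with rfl | hm
      · exact ⟨x - 1, p2 k hk1 (by omega) hk, p2 l hl1 (by omega) hl, by omega⟩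
      · exact ⟨m, p1 k m (by omega) hm hk, p1 l m (by omega) hm hl, by omega⟩
    · rintro ⟨m, hk, hl, hm⟩
      obtain ⟨u, hu, hku⟩ := hw.exists_isPrev (k := k) (by omega) (by omega)
      obtain ⟨v, hv, hlv⟩ := hw.exists_isPrev (k := l) (by omega) (by omega)
      rcases eq_or_lt_of_le hu with rfl | hu <;> rcases eq_or_lt_of_le hv with rfl | hv
      · exact ⟨_, hku, hlv, le_rfl⟩
      · have h1 := hk.unique (p2 k hk1 (by omega) hku)
        have h2 := hl.unique (p1 l v (by omega) hv hlv)
        exact absurd hlv (by rw [← h2, h1]; exact p3 l hl1 (by omega))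
      · have h1 := hl.unique (p2 l hl1 (by omega) hlv)
        have h2 := hk.unique (p1 k u (by omega) hu hku)
        exact absurd hku (by rw [← h2, h1]; exact p3 k hk1 (by omega))
      · have h1 := hk.unique (p1 k u (by omega) hu hku)
        have h2 := hl.unique (p1 l v (by omega) hv hlv)
        exact ⟨u, hku, by rwa [← h1, h2], by omega⟩
  · intro k h1 h2 h3
    rcases lt_trichotomy k x with hkx | rfl | hkx
    · rw [e1 k hkx, e1 (k - 1) (by omega)] at *
      have := h.rank k (by omega) (by omega) (by omega)
      omega
    · rw [e2 k le_rfl hxb, e1 (k - 1) (by omega), ← hR.const _ _ hrx]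
      omega
    · rw [e2 k (by omega) (by omega), e2 (k - 1) (by omega) (by omega)] at *
      rcases eq_or_lt_of_le (show k ≤ c + b by omega) with rfl | h4
      · have := hw.pos (c + b - 1) (by omega) (by omega)
        rw [hw.finish] at h3
        omega
      · have := h.rank k (by omega) h4 (by omega)
        omega

/-- Both walks have the classes of `R`, and in each of them the predecessor of `k` is one less than
the leftmost element of its class in the window. -/
theorem isPrev_transfer {W' : ℤ → ℤ} {ρ' : ℤ → ℕ} (h : Realizes a b R ρ c W)
    (h' : Realizes a b R ρ' c W') (hR : IsRanked a b R ρ) (hR' : IsRanked a b R ρ') (hb : 1 < b)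
    {k m : ℤ} (hm : c ≤ m) (hk : k ≤ c + b) (hp : IsPrev W k m) : IsPrev W' k m := by
  have hmk := hp.1
  obtain ⟨m', hm', hp'⟩ := h'.walk.exists_isPrev (k := k) (by omega) hk
  have hmk' := hp'.1
  have h1 := h.rel_isPrev hR hb hm hk hp
  have h2 := h'.rel_isPrev hR' hb hm' hk hp'
  obtain ⟨u, hu1, hu2, hu⟩ := (h.rel_le hR hb (by omega) (by omega) (by omega) hk).1 h2
  obtain ⟨v, hv1, hv2, hv⟩ := (h'.rel_le hR' hb (by omega) (by omega) (by omega) hk).1 h1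
  have h3 := hu2.unique hp
  have h4 := hv2.unique hp'
  have h5 := hu1.1
  have h6 := hv1.1
  rwa [show m = m' by omega]

/-- The walk is determined by the partition. -/
theorem eq_walk {W' : ℤ → ℤ} {ρ' : ℤ → ℕ} (h : Realizes a b R ρ c W)
    (h' : Realizes a b R ρ' c W') (hR : IsRanked a b R ρ) (hR' : IsRanked a b R ρ') (ha : 0 < a)
    (hab : a < b) {k : ℤ} (h1 : c ≤ k) (h2 : k ≤ c + b) : W k = W' k := by
  have hb : 1 < b := by omega
  have hb0 : 0 < b := by omega
  have tr : ∀ {k m : ℤ}, c ≤ m → k ≤ c + b → (IsPrev W k m ↔ IsPrev W' k m) := fun hm hk =>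
    ⟨h.isPrev_transfer h' hR hR' hb hm hk, h'.isPrev_transfer h hR' hR hb hm hk⟩
  -- Induction downwards from the right end, where both walks vanish.
  have main : ∀ N : ℕ, ∀ f, c ≤ f → c + b - N ≤ f → f ≤ c + b → W f = W' f := by
    intro N
    induction N with
    | zero =>
      intro f _ h2 h3
      rw [show f = c + b by push_cast at h2; omega, h.walk.finish, h'.walk.finish]
    | succ N ih =>
      intro g hg1 hg2 hg3
      push_cast at hg2
      rcases eq_or_lt_of_le hg1 with rfl | hg1
      · rw [h.walk.start, h'.walk.start]
      rcases eq_or_lt_of_le hg3 with rfl | hg3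
      · rw [h.walk.finish, h'.walk.finish]
      have ihg := ih (g + 1) (by omega) (by omega) (by omega)
      by_cases hle : W g ≤ W (g + 1)
      -- At a rise, `j` is the first later index with a value below `W g`. The fall into `j` is at
      -- most `a`, so `W g` lies in `(W j, W j + a]`. Transferred predecessors put `W' g` in the
      -- same interval, and the two values agree modulo `b > a`.
      · obtain ⟨j, ⟨hj1, hj2⟩, hj3⟩ := Int.exists_least_of_bdd
          (P := fun j => g < j ∧ W j < W g) ⟨g, fun z hz => hz.1.le⟩
          ⟨c + b, hg3, by rw [h.walk.finish]; exact h.walk.pos g hg1 hg3⟩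
        have hjb : j ≤ c + b :=
          hj3 _ ⟨hg3, by rw [h.walk.finish]; exact h.walk.pos g hg1 hg3⟩
        have low : ∀ i, g ≤ i → i < j → W g ≤ W i := by
          intro i hi1 hi2
          rcases eq_or_lt_of_le hi1 with rfl | hi1
          · rfl
          by_contra! hlt
          have := hj3 i ⟨hi1, hlt⟩
          omega
        have low' : ∀ N : ℕ, ∀ i, i ≤ g + N → g ≤ i → i < j → W' g ≤ W' i := by
          intro N
          induction N with
          | zero => intro i h1 h2 _; rw [show i = g by push_cast at h1; omega]
          | succ N ih2 =>
            intro i hi0 hi1 hi2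
            push_cast at hi0
            rcases eq_or_lt_of_le hi1 with rfl | hi1
            · rfl
            obtain ⟨m, hm, hp⟩ := h.walk.exists_isPrev (k := i) (by omega) (by omega)
            have h3 := hp.le_of_le hi1 (low i hi1.le hi2)
            have h4 := ((tr hm (by omega)).1 hp)
            have h5 := h4.1
            exact (ih2 m (by omega) h3 (by omega)).trans h4.2.1
        obtain ⟨m, hm, hp⟩ := h.walk.exists_isPrev (k := j) (by omega) hjb
        have hmg : m < g := by
          by_contra! hgm
          have := low m hgm hp.1
          have := hp.2.1
          omega
        have hj2' := ((tr hm hjb).1 hp).2.2 g hmg hj1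
        have hjj := ih j (by omega) (by omega) hjb
        have b1 := h.walk.sub_le hb0 (k := j) (by omega) hjb
        have b2 := h'.walk.sub_le hb0 (k := j) (by omega) hjb
        have b3 := low (j - 1) (by omega) (by omega)
        have b4 := low' (j - g).toNat (j - 1) (by omega) (by omega) (by omega)
        obtain ⟨e, he⟩ := dvd_sub (h.walk.modEq hg1.le hg3.le) (h'.walk.modEq hg1.le hg3.le)
        have he' : W g - W' g = b * e := by linarith
        have e1 : e < 1 := by
          by_contra! hh
          have : b * 1 ≤ b * e := by gcongr
          omega
        have e2 : -1 < e := by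
          by_contra! hh
          have : b * e ≤ b * (-1) := by gcongr
          omega
        have e3 : e = 0 := by omega
        rw [e3] at he'
        omega
      · have h3 : ¬ W' g ≤ W' (g + 1) := by
          intro hle'
          have hp : IsPrev W' (g + 1) g := ⟨by omega, hle', fun i _ _ => by omega⟩
          exact hle ((tr hg1.le (by omega)).2 hp).2.1
        have h4 := h.walk.eq_sub_of_lt hab hb0 (k := g + 1) (by omega) (by omega)
          (by rw [add_sub_cancel_right]; omega)
        have h5 := h'.walk.eq_sub_of_lt hab hb0 (k := g + 1) (by omega) (by omega)
          (by rw [add_sub_cancel_right]; omega)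
        rw [add_sub_cancel_right] at h4 h5
        omega
  exact main b.toNat k h1 (by omega) h2

theorem eq_rank {W' : ℤ → ℤ} {ρ' : ℤ → ℕ} (h : Realizes a b R ρ c W)
    (h' : Realizes a b R ρ' c W') (hR : IsRanked a b R ρ) (hR' : IsRanked a b R ρ') (ha : 0 < a)
    (hab : a < b) : ρ (c + 1) = ρ' (c + 1) := by
  have h1 := h.rank_start (by omega)
  have h2 := h'.rank_start (by omega)
  rw [h.eq_walk h' hR hR' ha hab (by omega) (by omega), h2] at h1
  have : b * (ρ (c + 1) : ℤ) = b * ρ' (c + 1) := by linarith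
  exact_mod_cast mul_left_cancel₀ (by omega) this

/-- Realizability is invariant under an automorphism of the line. -/
theorem translate {t : ℤ} (h : Realizes a b R ρ c W) (hb : 1 < b)
    {R' : Setoid ℤ} {ρ' : ℤ → ℕ} (hR : ∀ k l, R' (k + t) (l + t) ↔ R k l)
    (hρ : ∀ k, ρ' (k + t) = ρ k) : Realizes a b R' ρ' (c + t) (fun k => W (k - t)) where
  walk := h.walk.congr (by omega) fun k _ _ => by rw [add_sub_cancel_right]
  rel k l h1 h2 h3 h4 := by
    have e := hR (k - t) (l - t)
    rw [sub_add_cancel, sub_add_cancel] at e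
    rw [e, h.rel _ _ (by omega) (by omega) (by omega) (by omega)]
    constructor
    · rintro ⟨m, hk, hl, hm⟩
      refine ⟨m + t, ?_, ?_, by omega⟩
      · have := hk.shift (V' := fun k => W (k - t)) (e := 0) (t := t) (fun i => by simp)
        rwa [sub_add_cancel] at this
      · have := hl.shift (V' := fun k => W (k - t)) (e := 0) (t := t) (fun i => by simp)
        rwa [sub_add_cancel] at this
    · rintro ⟨m, hk, hl, hm⟩
      refine ⟨m - t, ?_, ?_, by omega⟩
      · have := hk.shift (V' := W) (e := 0) (t := -t) (fun i => by simp [sub_eq_add_neg])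
        simpa only [sub_eq_add_neg] using this
      · have := hl.shift (V' := W) (e := 0) (t := -t) (fun i => by simp [sub_eq_add_neg])
        simpa only [sub_eq_add_neg] using this
  rank k h1 h2 h3 := by
    have := hρ (k - t)
    rw [sub_add_cancel] at this
    rw [this]
    simp only [sub_right_comm k 1 t] at *
    exact h.rank _ (by omega) (by omega) h3

/-- Cuts move to the right one step at a time; a cut further left is reached by going back whole
periods, which preserve `R` and `ρ`. -/
theorem exists_all (h : Realizes a b R ρ c W) (hR : IsRanked a b R ρ) (ha : 0 < a) (hab : a < b)
    (hb : 2 < b) (hcop : IsCoprime a b) (c' : ℤ) : ∃ W', Realizes a b R ρ c' W' := by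
  have up : ∀ N : ℕ, ∃ W', Realizes a b R ρ (c + N) W' := by
    intro N
    induction N with
    | zero => exact ⟨W, by simpa using h⟩
    | succ N ih =>
      obtain ⟨W', hW'⟩ := ih
      push_cast
      rw [← add_assoc]
      exact hW'.exists_succ hR ha hab hb hcop
  have down : ∀ N : ℕ, ∀ c' W', Realizes a b R ρ c' W' →
      ∃ W'', Realizes a b R ρ (c' - N * (b - 1)) W'' := by
    intro N
    induction N with
    | zero => exact fun c' W' h => ⟨W', by simpa using h⟩
    | succ N ih =>
      intro c' W' h
      have := h.translate (by omega) (t := -(b - 1)) (R' := R) (ρ' := ρ) (fun k l => ?_) fun k => ?_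
      · obtain ⟨W'', hW''⟩ := ih _ _ this
        refine ⟨W'', ?_⟩
        convert hW'' using 1
        push_cast; ring
      · have hk := hR.periodic (k + -(b - 1))
        have hl := hR.periodic (l + -(b - 1))
        rw [neg_add_cancel_right] at hk hl
        exact ⟨fun hh => R.trans (R.trans (R.symm hk) hh) hl,
          fun hh => R.trans (R.trans hk hh) (R.symm hl)⟩
      · have hk := hR.periodic (k + -(b - 1))
        rw [neg_add_cancel_right] at hk
        exact hR.const _ _ hk
  set N := (c - c').toNat
  have hN : c - c' ≤ N * (b - 1) := by
    have h1 : c - c' ≤ N := Int.self_le_toNat _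
    have h2 : (N : ℤ) * 1 ≤ N * (b - 1) := by gcongr; omega
    omega
  obtain ⟨W', hW'⟩ := up (c' + N * (b - 1) - c).toNat
  obtain ⟨W'', hW''⟩ := down N _ _ hW'
  refine ⟨W'', ?_⟩
  convert hW'' using 1
  omega

end Realizes


/-! ### Sums over periods, and codes of walks with periodic steps. -/

theorem sum_Ioc_add_one (c k : ℤ) (h : c ≤ k) {M : Type*} [AddCommMonoid M] (g : ℤ → M) :
    ∑ i ∈ Finset.Ioc c (k + 1), g i = ∑ i ∈ Finset.Ioc c k, g i + g (k + 1) := by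
  have : Finset.Ioc c (k + 1) = insert (k + 1) (Finset.Ioc c k) := by
    ext x; simp only [Finset.mem_insert, Finset.mem_Ioc]; omega
  rw [this, Finset.sum_insert (by simp), add_comm]

theorem sum_Ioc_of_step {V g : ℤ → ℤ} {c k : ℤ} (h : c ≤ k)
    (hV : ∀ i, c < i → i ≤ k → V i = V (i - 1) + g i) :
    ∑ i ∈ Finset.Ioc c k, g i = V k - V c := by
  induction k, h using Int.leInduction with
  | base => simp
  | succ k hk ih =>
    rw [sum_Ioc_add_one c k hk, ih fun i h1 h2 => hV i h1 (by omega), hV (k + 1) (by omega) le_rfl,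
      add_sub_cancel_right]
    ring

theorem sum_Ioc_mul {s : ℤ → ℕ} {d : ℤ} (hd : 0 ≤ d) (hs : Function.Periodic s d) (q : ℕ) :
    ∑ i ∈ Finset.Ioc 0 (q * d), s i = q * ∑ i ∈ Finset.Ioc 0 d, s i := by
  induction q with
  | zero => simp
  | succ q ih =>
    have hq : 0 ≤ q * d := by positivity
    rw [← Finset.sum_subset_zero_on_sdiff
      (s₁ := Finset.Ioc 0 (q * d) ∪ Finset.Ioc (q * d) ((q + 1 : ℕ) * d)) (f := s) (g := s),
      Finset.sum_union, ih, add_mul, one_mul]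
    · congr 1
      have hh : Finset.Ioc ((q : ℤ) * d) ((q + 1 : ℕ) * d) =
          (Finset.Ioc 0 d).map (addRightEmbedding ((q : ℤ) * d)) := by
        rw [Finset.map_add_right_Ioc]
        congr 1
        · ring
        · push_cast; ring
      rw [hh, Finset.sum_map]
      refine Finset.sum_congr rfl fun i _ => ?_
      exact hs.int_mul q i
    · rw [Finset.disjoint_left]
      intro x
      simp only [Finset.mem_Ioc]
      omega
    · intro x
      simp only [Finset.mem_union, Finset.mem_Ioc]
      push_cast
      rintro (h | h) <;> constructor <;> nlinarith
    · intro x hx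
      exfalso
      simp only [Finset.mem_sdiff, Finset.mem_union, Finset.mem_Ioc] at hx
      push_cast at hx
      omega
    · exact fun _ _ => rfl

theorem add_period {V g : ℤ → ℤ} {t : ℤ} (hV : ∀ k, V k = V (k - 1) + g k)
    (hg : Function.Periodic g t) (k : ℤ) : V (k + t) = V k + (V t - V 0) := by
  induction k using Int.induction_on with
  | zero => rw [zero_add]; ring
  | succ i ih =>
    have h1 := hV (i + 1 + t)
    have h2 := hV (i + 1)
    have h3 := hg (i + 1)
    rw [show (i : ℤ) + 1 + t - 1 = i + t by ring] at h1
    rw [add_sub_cancel_right] at h2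
    linarith
  | pred i ih =>
    have h1 := hV (-i + t)
    have h2 := hV (-i)
    have h3 := hg (-i)
    rw [show -(i : ℤ) + t - 1 = -i - 1 + t by ring] at h1
    linarith

/-- The residues modulo `n` of the index `m` with `IsPrev V k m`: one class or none. -/
def code (V : ℤ → ℤ) (n k : ℤ) : Set ℤ := {x | ∃ j : ℤ, IsPrev V k (x + j * n)}

/-- Translation by a period of the steps adds a constant to `V`, which predecessors do not see. -/
theorem code_shift {V g : ℤ → ℤ} {n t : ℤ} (hV : ∀ k, V k = V (k - 1) + g k)
    (hg : Function.Periodic g t) (k x : ℤ) : x + t ∈ code V n (k + t) ↔ x ∈ code V n k := by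
  have e := add_period hV hg
  constructor
  · rintro ⟨j, hj⟩
    refine ⟨j, ?_⟩
    have := hj.shift (V' := V) (t := -t) (e := - (V t - V 0)) fun i => by
      have := e (i + -t)
      rw [neg_add_cancel_right] at this
      linarith
    convert this using 1 <;> ring
  · rintro ⟨j, hj⟩
    refine ⟨j, ?_⟩
    have := hj.shift (V' := V) (t := t) e
    convert this using 1; ring

theorem code_add_mul {V g : ℤ → ℤ} {n : ℤ} (hV : ∀ k, V k = V (k - 1) + g k)
    (hg : Function.Periodic g n) (k j : ℤ) : code V n (k + j * n) = code V n k := by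
  ext x
  have h := code_shift (n := n) hV (hg.int_mul j) k (x - j * n)
  simp only [Int.cast_id, sub_add_cancel] at h
  rw [h]
  constructor
  · rintro ⟨i, hi⟩
    exact ⟨i - j, by convert hi using 1; ring⟩
  · rintro ⟨i, hi⟩
    exact ⟨i + j, by convert hi using 1; ring⟩

/-! ### Translation-invariant partitions and first elements. -/

/-- No element of the class of `f` lies among the `d` integers before `f`. -/
def IsFirst (R : Setoid ℤ) (d f : ℤ) : Prop := ∀ i, f - d ≤ i → i < f → ¬ R i f

/-- `R` is an `a,b`-noncrossing partition with rank function `ρ`, invariant under translation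
by `d`. -/
structure IsInvariant (a b d : ℤ) (R : Setoid ℤ) (ρ : ℤ → ℕ) : Prop extends
    IsRanked a b R ρ where
  exists_realizes : ∀ c, ∃ W, Realizes a b R ρ c W
  shift : ∀ k l, R (k + d) (l + d) ↔ R k l

namespace IsInvariant

variable {a b d : ℤ} {R : Setoid ℤ} {ρ : ℤ → ℕ}

theorem periodic_mul (h : IsInvariant a b d R ρ) (k j : ℤ) : R k (k + j * (b - 1)) := by
  induction j using Int.induction_on with
  | zero => rw [zero_mul, add_zero]
  | succ i ih =>
    have := h.periodic (k + i * (b - 1))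
    rw [show k + (i + 1) * (b - 1) = k + i * (b - 1) + (b - 1) by ring]
    exact R.trans ih this
  | pred i ih =>
    have := h.periodic (k + (-i - 1) * (b - 1))
    rw [show k + (-i - 1) * (b - 1) + (b - 1) = k + -i * (b - 1) by ring] at this
    exact R.trans ih (R.symm this)

/-- The ranks are determined by the partition (`Realizes.eq_rank`), so a translation preserving `R`
preserves `ρ`. -/
theorem rank_add (h : IsInvariant a b d R ρ) (ha : 0 < a) (hab : a < b) (k : ℤ) :
    ρ (k + d) = ρ k := by
  obtain ⟨W, hW⟩ := h.exists_realizes (k - 1)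
  obtain ⟨W', hW'⟩ := h.exists_realizes (k - 1 + d)
  have h1 := hW.translate (t := d) (R' := R) (ρ' := fun k => ρ (k - d)) (by omega) h.shift
    fun k => by simp
  have hR : IsRanked a b R fun k => ρ (k - d) := by
    refine ⟨h.periodic, fun k l hkl => h.const _ _ ?_⟩
    rw [← h.shift]
    simpa using hkl
  have h2 := h1.eq_rank hW' hR h.toIsRanked ha hab
  simp only [show k - 1 + d + 1 = k + d by ring, add_sub_cancel_right] at h2
  exact h2.symm

theorem rank_add_period (h : IsInvariant a b d R ρ) (k : ℤ) : ρ (k + (b - 1)) = ρ k :=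
  (h.const _ _ (h.periodic k)).symm

theorem noncrossing (h : IsInvariant a b d R ρ) (hb : 1 < b) {i j k l : ℤ} (hij : i < j)
    (hjk : j < k) (hkl : k < l) (hl : l < i + b) (hik : R i k) (hjl : R j l) : R i j := by
  obtain ⟨W, hW⟩ := h.exists_realizes (i - 1)
  exact hW.noncrossing h.toIsRanked hb (by omega) hij hjk hkl (by omega) hik hjl

theorem isFirst_add (h : IsInvariant a b d R ρ) (f : ℤ) : IsFirst R d (f + d) ↔ IsFirst R d f := by
  constructor
  · intro hf i h1 h2 h3
    exact hf (i + d) (by omega) (by omega) ((h.shift _ _).2 h3)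
  · intro hf i h1 h2 h3
    refine hf (i - d) (by omega) (by omega) ((h.shift _ _).1 ?_)
    rwa [sub_add_cancel]

theorem not_rel_add (h : IsInvariant a b d R ρ) (hd : 0 < d) {f : ℤ} (hf : IsFirst R d f) :
    ¬ R f (f + d) := by
  intro hr
  refine hf (f - d) le_rfl (by omega) ((h.shift _ _).1 ?_)
  rwa [sub_add_cancel]

/-- A class reaching beyond `f + d` would cross its own translate by `d`, which is a different
class. -/
theorem isFirst_lt (h : IsInvariant a b d R ρ) (hd : 0 < d) (hdb : 2 * d ≤ b - 1) {f k : ℤ}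
    (hf : IsFirst R d f) (hfk : f < k) (hk : k < f + (b - 1)) (hr : R f k) : k < f + d := by
  by_contra! hle
  rcases eq_or_lt_of_le hle with rfl | hlt
  · exact h.not_rel_add hd hf hr
  have h1 : k + d < f + (b - 1) := by
    by_contra! h1
    refine hf (k - (b - 1)) (by omega) (by omega) ?_
    have := h.periodic (k - (b - 1))
    rw [sub_add_cancel] at this
    exact R.trans this (R.symm hr)
  exact h.not_rel_add hd hf
    (h.noncrossing (by omega) (j := f + d) (by omega) hlt (l := k + d) (by omega) (by omega) hr
      ((h.shift _ _).2 hr))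

theorem isFirst_unique (h : IsInvariant a b d R ρ) (hd : 0 < d) (hdb : 2 * d ≤ b - 1) {f k : ℤ}
    (hf : IsFirst R d f) (hk : IsFirst R d k) (hfk : f < k) (hlt : k < f + (b - 1)) : ¬ R f k :=
  fun hr => hk f (by have := h.isFirst_lt hd hdb hf hfk hlt hr; omega) hfk hr

/-! ### Recovering the partition from the ranks at first elements. -/

section Walk

variable {s : ℤ → ℕ} {V : ℤ → ℤ}

/-- From `f - 1` to `k`, `V` copies the walk cut at `f - 1`. A block that opens strictly between `f`
and `k` has no element shortly before `f`, by noncrossing; so it opens at a first element, where `s`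
holds its rank. -/
theorem isPrev_of_isFirst (h : IsInvariant a b d R ρ) (ha : 0 < a) (hab : a < b) (hd : 0 < d)
    (hdb : 2 * d ≤ b - 1)
    (hs : ∀ k, IsFirst R d k → s k = ρ k) (hs0 : ∀ k, ¬ IsFirst R d k → s k = 0)
    (hV : ∀ k, V k = V (k - 1) + (b * s k - a)) {f k : ℤ} (hf : IsFirst R d f)
    (hfk : f ≤ k) (hk : k < f + (b - 1)) (hr : R f k) : IsPrev V k (f - 1) := by
  obtain ⟨W, hW⟩ := h.exists_realizes (f - 1)
  have hkd : k < f + d := by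
    rcases eq_or_lt_of_le hfk with rfl | hfk
    · omega
    · exact h.isFirst_lt hd hdb hf hfk hk hr
  have key : ∀ i, f - 1 ≤ i → i ≤ k → V i = W i + V (f - 1) := by
    intro i hi
    induction i, hi using Int.leInduction with
    | base => intro _; rw [hW.walk.start, zero_add]
    | succ y hy ih =>
      intro hyk
      have ih := ih (by omega)
      have hVy := hV (y + 1)
      rw [add_sub_cancel_right] at hVy
      rcases hW.step_eq h.toIsRanked ha hab (k := y + 1) (by omega) (by omega) with
        ⟨h1, h2⟩ | ⟨⟨y', h1, h2, h3⟩, h4⟩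
      · rw [add_sub_cancel_right] at h2
        rw [hVy, hs, ih, h2]
        · ring
        intro i hi1 hi2 hi3
        by_cases hif : f ≤ i
        · exact h1 i (by omega) hi2 hi3
        rcases eq_or_lt_of_le (show f ≤ y + 1 by omega) with heq | hlt
        · rw [← heq] at hi1 hi2 hi3
          exact hf i hi1 hi2 hi3
        rcases eq_or_lt_of_le hyk with rfl | hyk
        · exact h1 f (by omega) hlt hr
        refine h1 f (by omega) hlt (h.noncrossing (by omega) hlt hyk (l := i + (b - 1)) (by omega)
          (by omega) hr (R.trans (R.symm hi3) (h.periodic i)))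
      · rw [add_sub_cancel_right] at h4
        rw [hVy, hs0, ih, h4]
        · push_cast; ring
        · exact fun hfirst => hfirst y' (by omega) h2 h3
  have hp : IsPrev W k (f - 1) := by
    obtain ⟨m, hm1, hm2, hm3⟩ := (hW.rel_le h.toIsRanked (by omega) (by omega) (by omega)
      (by omega) (by omega)).1 hr
    have := hW.walk.isPrev_start (by omega)
    rw [sub_add_cancel] at this
    rwa [this.unique hm1]
  exact hp.congr key

/-- The same comparison with the walk cut at `z - 1`, for consecutive elements `z`, `k` of a class
that need not have a first element. -/
theorem lt_of_rel (h : IsInvariant a b d R ρ) (ha : 0 < a) (hab : a < b)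
    (hdb : 2 * d ≤ b - 1)
    (hs : ∀ k, IsFirst R d k → s k = ρ k) (hs0 : ∀ k, ¬ IsFirst R d k → s k = 0)
    (hV : ∀ k, V k = V (k - 1) + (b * s k - a)) {z k : ℤ} (hzk : z < k) (hkz : k ≤ z + d)
    (hr : R z k) (hno : ∀ i, z < i → i < k → ¬ R i k) {i : ℤ} (hi1 : z ≤ i) (hi2 : i < k) :
    V k < V i := by
  obtain ⟨W, hW⟩ := h.exists_realizes (z - 1)
  have key : ∀ i, z ≤ i → i ≤ k → V i = W i + (V z - W z) := by
    intro i hi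
    induction i, hi using Int.leInduction with
    | base => intro _; ring
    | succ y hy ih =>
      intro hyk
      have ih := ih (by omega)
      have hVy := hV (y + 1)
      rw [add_sub_cancel_right] at hVy
      rcases hW.step_eq h.toIsRanked ha hab (k := y + 1) (by omega) (by omega) with
        ⟨h1, h2⟩ | ⟨⟨y', h1, h2, h3⟩, h4⟩
      · rw [add_sub_cancel_right] at h2
        rw [hVy, hs, ih, h2]
        · ring
        intro i hi1 hi2 hi3
        by_cases hif : z ≤ i
        · exact h1 i (by omega) hi2 hi3
        rcases eq_or_lt_of_le hyk with rfl | hyk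
        · exact h1 z (by omega) (by omega) hr
        refine h1 z (by omega) (by omega) (h.noncrossing (by omega) (by omega) hyk
          (l := i + (b - 1)) (by omega) (by omega) hr (R.trans (R.symm hi3) (h.periodic i)))
      · rw [add_sub_cancel_right] at h4
        rw [hVy, hs0, ih, h4]
        · push_cast; ring
        · exact fun hfirst => hfirst y' (by omega) h2 h3
  have := hW.lt_of_rel h.toIsRanked (by omega) (by omega) hzk (by omega) hr hi1 hi2
  rw [key i hi1 hi2.le, key k hzk.le le_rfl]
  omega

/-- The class of `k` continues to the left forever with gaps at most `d`, and `V` at the right end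
of each gap is below all its values on the gap. Hence `k` is a strict record and has no predecessor.
-/
theorem lt_of_no_first (h : IsInvariant a b d R ρ) (ha : 0 < a) (hab : a < b)
    (hdb : 2 * d ≤ b - 1)
    (hs : ∀ k, IsFirst R d k → s k = ρ k) (hs0 : ∀ k, ¬ IsFirst R d k → s k = 0)
    (hV : ∀ k, V k = V (k - 1) + (b * s k - a)) {k i : ℤ}
    (hk : ∀ f, R f k → ¬ IsFirst R d f) (hik : i < k) : V k < V i := by
  have main : ∀ N : ℕ, ∀ k, (∀ f, R f k → ¬ IsFirst R d f) → ∀ i, k - N ≤ i → i < k →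
      V k < V i := by
    intro N
    induction N with
    | zero => intro k _ i h1 h2; push_cast at h1; omega
    | succ N ih =>
      intro k hk i h1 h2
      have hkk := hk k (R.refl k)
      unfold IsFirst at hkk
      push Not at hkk
      obtain ⟨u, hu1, hu2, hu3⟩ := hkk
      obtain ⟨z, ⟨hz1, hz2⟩, hz3⟩ := Int.exists_greatest_of_bdd
        (P := fun z => z < k ∧ R z k) ⟨k, fun z hz => hz.1.le⟩ ⟨u, hu2, hu3⟩
      have hz4 := hz3 u ⟨hu2, hu3⟩
      have key : ∀ {i : ℤ}, z ≤ i → i < k → V k < V i := fun hi1 hi2 =>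
        h.lt_of_rel ha hab hdb hs hs0 hV hz1 (by omega) hz2
          (fun i hi1 hi2 hi3 => by have := hz3 i ⟨hi2, hi3⟩; omega) hi1 hi2
      by_cases hiz : z ≤ i
      · exact key hiz h2
      · exact (key le_rfl hz1).trans (ih z (fun f hf => hk f (R.trans hf hz2)) i
          (by push_cast at h1; omega) (by omega))
  exact main (k - i).toNat k hk i (by omega) hik

/-- Two such classes would both have all gaps at most `d`, so they would interleave as `u < i < y <
z` with `z < u + b`, a crossing. -/
theorem rel_of_no_first (h : IsInvariant a b d R ρ) (hd : 0 < d)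
    (hdb : 2 * d ≤ b - 1) {k l : ℤ}
    (hk : ∀ f, R f k → ¬ IsFirst R d f) (hl : ∀ f, R f l → ¬ IsFirst R d f) : R k l := by
  by_contra hkl
  have hbig : l < k + ((l - k).toNat + 1) * (b - 1) := by
    have h1 : l - k ≤ (l - k).toNat := Int.self_le_toNat _
    have h2 : (((l - k).toNat : ℤ) + 1) * 1 ≤ ((l - k).toNat + 1) * (b - 1) := by gcongr; omega
    omega
  obtain ⟨z, ⟨hz1, hz2⟩, hz3⟩ := Int.exists_least_of_bdd
    (P := fun z => l < z ∧ R z k) ⟨l, fun z hz => hz.1.le⟩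
    ⟨_, hbig, R.symm (h.periodic_mul k _)⟩
  have hz := hk z hz2
  unfold IsFirst at hz
  push Not at hz
  obtain ⟨i, hi1, hi2, hi3⟩ := hz
  have hik := R.trans hi3 hz2
  have hil : i < l := by
    rcases lt_trichotomy i l with hh | rfl | hh
    · exact hh
    · exact absurd (R.symm hik) hkl
    · have := hz3 i ⟨hh, hik⟩
      omega
  obtain ⟨y, ⟨hy1, hy2⟩, hy3⟩ := Int.exists_least_of_bdd
    (P := fun y => i < y ∧ R y l) ⟨i, fun z hz => hz.1.le⟩ ⟨l, hil, R.refl l⟩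
  have hyl := hy3 l ⟨hil, R.refl l⟩
  have hy := hl y hy2
  unfold IsFirst at hy
  push Not at hy
  obtain ⟨u, hu1, hu2, hu3⟩ := hy
  have hui : ¬ R u i := fun hh =>
    hkl (R.trans (R.symm (R.trans hh hik)) (R.trans hu3 hy2))
  have hlt : u < i := by
    rcases lt_trichotomy u i with hh | rfl | hh
    · exact hh
    · exact absurd (R.refl _) hui
    · have := hy3 u ⟨hh, R.trans hu3 hy2⟩
      omega
  exact hui (h.noncrossing (by omega) hlt hy1 (by omega : y < z) (by omega) hu3 hi3)

theorem first_periodic (h : IsInvariant a b d R ρ)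
    (hs : ∀ k, IsFirst R d k → s k = ρ k) (hs0 : ∀ k, ¬ IsFirst R d k → s k = 0) :
    Function.Periodic s (b - 1) := by
  intro k
  have hf : IsFirst R d (k + (b - 1)) ↔ IsFirst R d k := by
    constructor
    · intro hf i h1 h2 h3
      exact hf (i + (b - 1)) (by omega) (by omega)
        (R.trans (R.symm (h.periodic i)) (R.trans h3 (h.periodic k)))
    · intro hf i h1 h2 h3
      have := h.periodic (i - (b - 1))
      rw [sub_add_cancel] at this
      exact hf (i - (b - 1)) (by omega) (by omega)
        (R.trans this (R.trans h3 (R.symm (h.periodic k))))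
  by_cases hk : IsFirst R d k
  · rw [hs _ hk, hs _ (hf.2 hk), h.rank_add_period]
  · rw [hs0 _ hk, hs0 _ (mt hf.1 hk)]

theorem first_periodic' (h : IsInvariant a b d R ρ) (ha : 0 < a) (hab : a < b)
    (hs : ∀ k, IsFirst R d k → s k = ρ k) (hs0 : ∀ k, ¬ IsFirst R d k → s k = 0) :
    Function.Periodic s d := by
  intro k
  by_cases hk : IsFirst R d k
  · rw [hs _ hk, hs _ ((h.isFirst_add k).2 hk), h.rank_add ha hab]
  · rw [hs0 _ hk, hs0 _ (mt (h.isFirst_add k).1 hk)]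

theorem code_of_isFirst (h : IsInvariant a b d R ρ) (ha : 0 < a) (hab : a < b) (hd : 0 < d)
    (hdb : 2 * d ≤ b - 1)
    (hs : ∀ k, IsFirst R d k → s k = ρ k) (hs0 : ∀ k, ¬ IsFirst R d k → s k = 0)
    (hV : ∀ k, V k = V (k - 1) + (b * s k - a)) {f k : ℤ} (hf : IsFirst R d f) (hr : R f k) :
    code V (b - 1) k = {x | ∃ j : ℤ, x + j * (b - 1) = f - 1} := by
  have hg : Function.Periodic (fun k => b * (s k : ℤ) - a) (b - 1) := fun k => by
    simp only [h.first_periodic hs hs0 k]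
  have hk := Int.emod_add_mul_ediv (k - f) (b - 1)
  set r := (k - f) % (b - 1) with hrdef
  set j := (k - f) / (b - 1)
  have hr0 : 0 ≤ r := Int.emod_nonneg _ (by omega)
  have hr1 : r < b - 1 := Int.emod_lt_of_pos _ (by omega)
  have hkj : k = f + r + j * (b - 1) := by linarith
  rw [hkj, code_add_mul hV hg]
  have hp := h.isPrev_of_isFirst ha hab hd hdb hs hs0 hV hf (k := f + r) (by omega) (by omega)
    (by rw [hkj] at hr; exact R.trans hr (R.symm (h.periodic_mul _ j)))
  ext x
  exact ⟨fun ⟨i, hi⟩ => ⟨i, hi.unique hp⟩, fun ⟨i, hi⟩ => ⟨i, by rw [hi]; exact hp⟩⟩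

theorem rel_iff_code (h : IsInvariant a b d R ρ) (ha : 0 < a) (hab : a < b) (hd : 0 < d)
    (hdb : 2 * d ≤ b - 1)
    (hs : ∀ k, IsFirst R d k → s k = ρ k) (hs0 : ∀ k, ¬ IsFirst R d k → s k = 0)
    (hV : ∀ k, V k = V (k - 1) + (b * s k - a)) (k l : ℤ) :
    R k l ↔ code V (b - 1) k = code V (b - 1) l := by
  have hem : ∀ k, (∀ f, R f k → ¬ IsFirst R d f) → code V (b - 1) k = ∅ := by
    intro k hk
    ext x
    simp only [Set.mem_empty_iff_false, iff_false]
    rintro ⟨j, hj⟩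
    have := h.lt_of_no_first ha hab hdb hs hs0 hV hk hj.1
    have := hj.2.1
    omega
  have hmem : ∀ f : ℤ, f - 1 ∈ {x | ∃ j : ℤ, x + j * (b - 1) = f - 1} :=
    fun f => ⟨0, by ring⟩
  by_cases hk : ∃ f, R f k ∧ IsFirst R d f
  · obtain ⟨f, hfk, hf⟩ := hk
    rw [h.code_of_isFirst ha hab hd hdb hs hs0 hV hf hfk]
    constructor
    · intro hr
      rw [h.code_of_isFirst ha hab hd hdb hs hs0 hV hf (R.trans hfk hr)]
    · intro he
      by_cases hl : ∃ f, R f l ∧ IsFirst R d f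
      · obtain ⟨g, hgl, hg⟩ := hl
        rw [h.code_of_isFirst ha hab hd hdb hs hs0 hV hg hgl] at he
        obtain ⟨j, hj⟩ := he ▸ hmem f
        have := h.periodic_mul f j
        rw [show f + j * (b - 1) = g by omega] at this
        exact R.trans (R.symm hfk) (R.trans this hgl)
      · push Not at hl
        rw [hem l hl] at he
        exact absurd (he ▸ hmem f) (Set.notMem_empty _)
  · push Not at hk
    constructor
    · intro hr
      rw [hem k hk, hem l fun f hf => hk f (R.trans hf (R.symm hr))]
    · intro he
      refine h.rel_of_no_first hd hdb hk fun f hf hf' => ?_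
      rw [hem k hk, h.code_of_isFirst ha hab hd hdb hs hs0 hV hf' hf] at he
      exact absurd (he ▸ hmem f) (Set.notMem_empty _)

/-- The walk cut at `0` has value `a` at `b - 1`, so the ranks of its blocks add up to `a`. First
elements within one period lie in different blocks and account for part of this sum. -/
theorem sum_le (h : IsInvariant a b d R ρ) (ha : 0 < a) (hab : a < b) (hd : 0 < d)
    (hdb : 2 * d ≤ b - 1)
    (hs : ∀ k, IsFirst R d k → s k = ρ k) (hs0 : ∀ k, ¬ IsFirst R d k → s k = 0) :
    (∑ k ∈ Finset.Ioc 0 (b - 1), s k : ℕ) ≤ a := by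
  classical
  obtain ⟨W, hW⟩ := h.exists_realizes 0
  set r : ℤ → ℕ := fun k => if ∀ i, 0 < i → i < k → ¬ R i k then ρ k else 0 with hr
  have h1 : ∑ k ∈ Finset.Ioc 0 (b - 1), (b * (r k : ℤ) - a) = W (b - 1) - W 0 := by
    refine sum_Ioc_of_step (by omega) fun i hi1 hi2 => ?_
    rcases hW.step_eq h.toIsRanked ha hab hi1 (by omega) with ⟨h1, h2⟩ | ⟨h1, h2⟩
    · simp only [hr]
      rw [if_pos h1, h2]; ring
    · simp only [hr]
      rw [if_neg (by push Not; exact h1), h2]; push_cast; ring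
  have h2 := hW.walk.last hab ha (by omega)
  rw [zero_add] at h2
  rw [hW.walk.start, h2, Finset.sum_sub_distrib, ← Finset.mul_sum] at h1
  simp only [Finset.sum_const, Int.card_Ioc, nsmul_eq_mul] at h1
  rw [sub_zero, Int.toNat_of_nonneg (by omega)] at h1
  have h3 : b * ∑ k ∈ Finset.Ioc 0 (b - 1), (r k : ℤ) = b * a := by linarith
  have h4 : ∑ k ∈ Finset.Ioc 0 (b - 1), (r k : ℤ) = a := mul_left_cancel₀ (by omega) h3
  rw [← h4]
  suffices hle : ∑ k ∈ Finset.Ioc 0 (b - 1), s k ≤ ∑ k ∈ Finset.Ioc 0 (b - 1), r k by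
    exact_mod_cast hle
  -- `g k` is the least positive element of the class of `k`, the place where `r` records its rank.
  have hex : ∀ k, ∃ g, 0 < k → k < b → (0 < g ∧ g ≤ k ∧ R g k ∧ ∀ i, 0 < i → i < g → ¬ R i g) := by
    intro k
    by_cases hk : 0 < k
    · obtain ⟨g, ⟨hg1, hg2⟩, hg3⟩ := Int.exists_least_of_bdd
        (P := fun g => 0 < g ∧ R g k) ⟨0, fun z hz => hz.1.le⟩ ⟨k, hk, R.refl k⟩
      refine ⟨g, fun _ _ => ⟨hg1, hg3 k ⟨hk, R.refl k⟩, hg2, fun i h1 h2 h3 => ?_⟩⟩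
      have := hg3 i ⟨h1, R.trans h3 hg2⟩
      omega
    · exact ⟨0, fun hk' => absurd hk' hk⟩
  choose g hg using hex
  calc ∑ k ∈ Finset.Ioc 0 (b - 1), s k
      = ∑ k ∈ (Finset.Ioc 0 (b - 1)).filter (IsFirst R d), r (g k) := by
        rw [Finset.sum_filter]
        refine Finset.sum_congr rfl fun k hk => ?_
        rw [Finset.mem_Ioc] at hk
        obtain ⟨g1, g2, g3, g4⟩ := hg k hk.1 (by omega)
        split_ifs with hf
        · simp only [hr]
          rw [if_pos g4, hs k hf, h.const _ _ g3]
        · exact hs0 k hf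
    _ = ∑ k ∈ ((Finset.Ioc 0 (b - 1)).filter (IsFirst R d)).image g, r k := by
        rw [Finset.sum_image]
        intro k hk l hl hkl
        simp only [Finset.coe_filter, Finset.mem_Ioc, Set.mem_ofPred_eq] at hk hl
        have hR : R k l := by
          have e1 := (hg k hk.1.1 (by omega)).2.2.1
          have e2 := (hg l hl.1.1 (by omega)).2.2.1
          rw [← hkl] at e2
          exact R.trans (R.symm e1) e2
        rcases lt_trichotomy k l with hlt | heq | hlt
        · exact absurd hR (h.isFirst_unique hd hdb hk.2 hl.2 hlt (by omega))
        · exact heq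
        · exact absurd (R.symm hR) (h.isFirst_unique hd hdb hl.2 hk.2 hlt (by omega))
    _ ≤ ∑ k ∈ Finset.Ioc 0 (b - 1), r k := by
        refine Finset.sum_le_sum_of_subset fun x hx => ?_
        simp only [Finset.mem_image, Finset.mem_filter, Finset.mem_Ioc] at hx ⊢
        obtain ⟨k, ⟨hk, -⟩, rfl⟩ := hx
        have := hg k hk.1 (by omega)
        omega

end Walk
end IsInvariant


/-! ### Building an invariant partition from a sequence of ranks. -/

theorem exists_of_step (g : ℤ → ℤ) : ∃ V : ℤ → ℤ, ∀ k, V k = V (k - 1) + g k := by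
  refine ⟨fun k => ∑ i ∈ Finset.Ioc 0 k, g i - ∑ i ∈ Finset.Ioc k 0, g i, fun k => ?_⟩
  rcases lt_or_ge 0 k with hk | hk
  · have h := sum_Ioc_add_one 0 (k - 1) (by omega) g
    rw [sub_add_cancel] at h
    simp only [h]
    rw [Finset.Ioc_eq_empty (a := k) (by omega), Finset.Ioc_eq_empty (a := k - 1) (by omega)]
    simp
  · have h : Finset.Ioc (k - 1) 0 = insert k (Finset.Ioc k 0) := by
      ext x; simp only [Finset.mem_insert, Finset.mem_Ioc]; omega
    simp only [h]
    rw [Finset.sum_insert (by simp), Finset.Ioc_eq_empty (b := k) (by omega),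
      Finset.Ioc_eq_empty (b := k - 1) (by omega)]
    simp

section Quasiperiodic

variable {V : ℤ → ℤ} {d D : ℤ}

theorem add_mul_period (hV : ∀ k, V (k + d) = V k + D) (k j : ℤ) : V (k + j * d) = V k + j * D := by
  induction j using Int.induction_on with
  | zero => simp
  | succ i ih =>
    have := hV (k + i * d)
    rw [show k + ((i : ℤ) + 1) * d = k + i * d + d by ring, this, ih]; ring
  | pred i ih =>
    have := hV (k + (-i - 1) * d)
    rw [show k + (-(i : ℤ) - 1) * d + d = k + -i * d by ring, ih] at this
    linarith

theorem exists_le_of_ge (hV : ∀ k, V (k + d) = V k + D) (hd : 0 < d) (hD : 0 < D) :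
    ∃ c, ∀ m, c ≤ m → V c ≤ V m := by
  obtain ⟨c, hc, hmin⟩ := (Finset.Ico 0 d).exists_min_image V ⟨0, by simp [hd]⟩
  rw [Finset.mem_Ico] at hc
  refine ⟨c, fun m hm => ?_⟩
  have h1 := add_mul_period hV (m % d) (m / d)
  rw [mul_comm, Int.emod_add_mul_ediv] at h1
  have h2 := hmin (m % d) (Finset.mem_Ico.2 ⟨Int.emod_nonneg _ hd.ne', Int.emod_lt_of_pos _ hd⟩)
  have h3 : 0 ≤ m / d * D := mul_nonneg (Int.ediv_nonneg (by omega) hd.le) hD.le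
  omega

/-- Negative drift lifts all earlier periods above the minimum over `[0, d)`; the first index
reaching that minimum makes the inequality strict. -/
theorem exists_lt_of_lt (hV : ∀ k, V (k + d) = V k + D) (hd : 0 < d) (hD : D < 0) :
    ∃ z, ∀ m, m < z → V z < V m := by
  obtain ⟨c, hc, hmin⟩ := (Finset.Ico 0 d).exists_min_image V ⟨0, by simp [hd]⟩
  rw [Finset.mem_Ico] at hc
  obtain ⟨z, ⟨hz1, hz2⟩, hz3⟩ := Int.exists_least_of_bdd
    (P := fun z => 0 ≤ z ∧ V z ≤ V c) ⟨0, fun z hz => hz.1⟩ ⟨c, hc.1, le_rfl⟩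
  have hzc := hz3 c ⟨hc.1, le_rfl⟩
  refine ⟨z, fun m hm => ?_⟩
  rcases le_or_gt 0 m with h0 | h0
  · by_contra! hlt
    have := hz3 m ⟨h0, hlt.trans hz2⟩
    omega
  · have h1 := add_mul_period hV (m % d) (m / d)
    rw [mul_comm, Int.emod_add_mul_ediv] at h1
    have h2 := hmin (m % d) (Finset.mem_Ico.2 ⟨Int.emod_nonneg _ hd.ne', Int.emod_lt_of_pos _ hd⟩)
    have h3 : 0 < m / d * D := mul_pos_of_neg_of_neg (Int.ediv_neg_of_neg_of_pos h0 hd) hD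
    omega

/-- If `m + d < t`, comparing `m` with `m + d` gives `D > 0`, while comparing `t - d` with `t` gives
`D < 0`. -/
theorem IsPrev.le_add (hV : ∀ k, V (k + d) = V k + D) (hd : 0 < d) {t m : ℤ}
    (h : IsPrev V t m) : t ≤ m + d := by
  by_contra! hlt
  have h1 := h.2.2 (m + d) (by omega) hlt
  have h2 := h.2.2 (t - d) (by omega) (by omega)
  have h3 := hV m
  have h4 := hV (t - d)
  rw [sub_add_cancel] at h4
  have h5 := h.2.1
  omega

end Quasiperiodic

/-- The relation of having the same code, as an equivalence relation. -/
def codeSetoid (V : ℤ → ℤ) (n : ℤ) : Setoid ℤ := Setoid.ker (code V n)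

theorem codeSetoid_apply {V : ℤ → ℤ} {n k l : ℤ} :
    codeSetoid V n k l ↔ code V n k = code V n l := Iff.rfl

open Classical in
/-- The rank of the class of `k` under `codeSetoid`; the class without predecessor has rank `z`. -/
noncomputable def codeRank (V : ℤ → ℤ) (s : ℤ → ℕ) (z : ℕ) (k : ℤ) : ℕ :=
  if h : ∃ m, IsPrev V k m then s (h.choose + 1) else z

theorem codeRank_of_isPrev {V : ℤ → ℤ} {s : ℤ → ℕ} {z : ℕ} {k m : ℤ} (h : IsPrev V k m) :
    codeRank V s z k = s (m + 1) := by
  have hex : ∃ m, IsPrev V k m := ⟨m, h⟩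
  rw [codeRank, dif_pos hex, hex.choose_spec.unique h]

theorem codeRank_of_not {V : ℤ → ℤ} {s : ℤ → ℕ} {z : ℕ} {k : ℤ} (h : ∀ m, ¬ IsPrev V k m) :
    codeRank V s z k = z := by
  rw [codeRank, dif_neg (by push Not; exact h)]

theorem code_of_isPrev {V : ℤ → ℤ} {n k m : ℤ} (h : IsPrev V k m) :
    code V n k = {x | ∃ j : ℤ, x + j * n = m} := by
  ext x
  exact ⟨fun ⟨i, hi⟩ => ⟨i, hi.unique h⟩, fun ⟨i, hi⟩ => ⟨i, by rw [hi]; exact h⟩⟩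

theorem code_of_not {V : ℤ → ℤ} {n k : ℤ} (h : ∀ m, ¬ IsPrev V k m) : code V n k = ∅ := by
  ext x
  exact ⟨fun ⟨i, hi⟩ => h _ hi, fun hx => absurd hx (Set.notMem_empty _)⟩

section Construction

variable {a b d : ℤ} {s : ℤ → ℕ} {V : ℤ → ℤ} {z : ℕ}

theorem isRanked_code (hsn : Function.Periodic s (b - 1))
    (hV : ∀ k, V k = V (k - 1) + (b * s k - a)) :
    IsRanked a b (codeSetoid V (b - 1)) (codeRank V s z) := by
  have hg : Function.Periodic (fun k => b * (s k : ℤ) - a) (b - 1) := fun k => by simp only [hsn k]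
  constructor
  · intro k
    rw [codeSetoid_apply]
    have := code_add_mul hV hg k 1
    rw [one_mul] at this
    exact this.symm
  · intro k l h
    rw [codeSetoid_apply] at h
    by_cases hk : ∃ m, IsPrev V k m
    · obtain ⟨m, hm⟩ := hk
      have hmem : m ∈ code V (b - 1) k := ⟨0, by simpa using hm⟩
      obtain ⟨j, hj⟩ := h ▸ hmem
      rw [codeRank_of_isPrev hm, codeRank_of_isPrev hj, add_right_comm]
      exact (hsn.int_mul j _).symm
    · push Not at hk
      rw [codeRank_of_not hk, codeRank_of_not]
      intro m hm
      have hmem : m ∈ code V (b - 1) l := ⟨0, by simpa using hm⟩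
      obtain ⟨j, hj⟩ := h ▸ hmem
      exact hk _ hj

/-- A cut of the line at which `V` starts like the walk of a Dyck path. -/
theorem realizes_code (hab : a < b) (hb : 2 < b) (hcop : IsCoprime a b)
    (hsn : Function.Periodic s (b - 1))
    (hV : ∀ k, V k = V (k - 1) + (b * s k - a))
    (hsum : (∑ k ∈ Finset.Ioc 0 (b - 1), s k : ℕ) + (z : ℤ) = a) {c : ℤ}
    (hc : (z = 0 ∧ ∀ m, c ≤ m → V c ≤ V m) ∨ (0 < z ∧ ∀ m, m < c + 1 → V (c + 1) < V m)) :
    ∃ W, Realizes a b (codeSetoid V (b - 1)) (codeRank V s z) c W := by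
  have hg : Function.Periodic (fun k => b * (s k : ℤ) - a) (b - 1) := fun k => by simp only [hsn k]
  have hper : ∀ k, V (k + (b - 1)) = V k + (a - b * z) := by
    intro k
    rw [add_period hV hg k]
    have h1 := sum_Ioc_of_step (V := V) (c := 0) (k := b - 1) (by omega) fun i _ _ => hV i
    rw [Finset.sum_sub_distrib, ← Finset.mul_sum] at h1
    simp only [Finset.sum_const, Int.card_Ioc, nsmul_eq_mul] at h1
    rw [sub_zero, Int.toNat_of_nonneg (by omega)] at h1
    push_cast at hsum
    rw [show ∑ k ∈ Finset.Ioc 0 (b - 1), (s k : ℤ) = a - z by linarith] at h1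
    rw [← h1]; ring
  have hmod : ∀ k, c ≤ k → b ∣ V k - V c + a * (k - c) := by
    intro k hk
    induction k, hk using Int.leInduction with
    | base => simp
    | succ k hk ih =>
      obtain ⟨e, he⟩ := ih
      have h1 := hV (k + 1)
      rw [add_sub_cancel_right] at h1
      exact ⟨e + s (k + 1), by rw [h1]; linear_combination he⟩
  -- The lift by `b * z` inserts the rise of the class without predecessor at the first step. It
  -- also makes the value at `c + b - 1` equal to `a`, so the last step is a plain fall to `0`.
  set W : ℤ → ℤ := fun k => if k = c ∨ k = c + b then 0 else V k - V c + b * z with hWdef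
  have w0 : W c = 0 := by simp [hWdef]
  have w1 : W (c + b) = 0 := by simp [hWdef]
  have w2 : ∀ k, c < k → k < c + b → W k = V k + (b * z - V c) := by
    intro k h1 h2
    simp only [hWdef]
    rw [if_neg (by omega)]; ring
  have wl : W (c + b - 1) = a := by
    rw [w2 _ (by omega) (by omega), show c + b - 1 = c + (b - 1) by ring, hper]; ring
  have hstep1 := hV (c + 1)
  rw [add_sub_cancel_right] at hstep1
  have hwalk : IsWalk a b c W := by
    refine ⟨w0, w1, fun k h1 h2 => ?_, fun k h1 h2 => ?_⟩
    · rw [w2 k h1 h2]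
      rcases hc with ⟨hz, hc⟩ | ⟨hz, hc⟩
      · have h3 := hc k h1.le
        have h4 : V c ≠ V k := by
          intro heq
          have h5 := hmod k h1.le
          rw [heq, sub_self, zero_add] at h5
          have := Int.le_of_dvd (by omega) (hcop.symm.dvd_of_dvd_mul_left h5)
          omega
        rw [hz]
        push_cast
        omega
      · have h3 := hc (k - (b - 1)) (by omega)
        have h4 := hper (k - (b - 1))
        rw [sub_add_cancel] at h4
        have h5 : 0 ≤ b * (s (c + 1) : ℤ) := by positivity
        omega
    · rcases eq_or_lt_of_le h2 with rfl | h2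
      · exact ⟨0, by rw [w1, wl]; simp⟩
      rcases eq_or_lt_of_le (show c + 1 ≤ k by omega) with rfl | h3
      · refine ⟨s (c + 1) + z, ?_⟩
        rw [add_sub_cancel_right, w0, w2 _ h1 h2, hstep1]
        push_cast; ring
      · refine ⟨s k, ?_⟩
        rw [w2 k h1 h2, w2 (k - 1) (by omega) (by omega), hV k]
        ring
  have prevV : ∀ k m, k < c + b → c < m → IsPrev W k m → IsPrev V k m := by
    intro k m hk hm hp
    have := hp.1
    exact hp.congr (e := -(b * z - V c)) fun i _ _ => by rw [w2 i (by omega) (by omega)]; ring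
  -- Predecessor `c` in the window is genuine when `z = 0`; when `z > 0` it marks the indices with
  -- no predecessor under `V`.
  have prev0 : ∀ k, c < k → k < c + b → IsPrev W k c →
      (z = 0 ∧ IsPrev V k c) ∨ (0 < z ∧ ∀ m, ¬ IsPrev V k m) := by
    intro k h1 h2 hp
    have hlow : ∀ i, c < i → i < k → V k < V i := by
      intro i hi1 hi2
      have := hp.2.2 i hi1 hi2
      rw [w2 i (by omega) (by omega), w2 k h1 h2] at this
      omega
    rcases hc with ⟨hz, hc⟩ | ⟨hz, hc⟩
    · exact Or.inl ⟨hz, h1, hc k h1.le, hlow⟩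
    · refine Or.inr ⟨hz, fun m hm => ?_⟩
      have hm1 := hm.1
      have hm2 := hm.2.1
      by_cases hcm : c < m
      · have := hlow m hcm hm1
        omega
      · have h3 := hc m (by omega)
        rcases eq_or_lt_of_le (show c + 1 ≤ k by omega) with rfl | h4
        · omega
        · have := hlow (c + 1) (by omega) h4
          omega
  refine ⟨W, hwalk, ?_, ?_⟩
  · intro k l hk1 hk2 hl1 hl2
    rw [codeSetoid_apply]
    have hcode : ∀ k, c < k → k < c + b → ∃ m, c ≤ m ∧ IsPrev W k m ∧ code V (b - 1) k =
        {x | (0 < z → m ≠ c) ∧ ∃ j : ℤ, x + j * (b - 1) = m} := by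
      intro k h1 h2
      obtain ⟨m, hm, hp⟩ := hwalk.exists_isPrev h1 h2.le
      refine ⟨m, hm, hp, ?_⟩
      rcases eq_or_lt_of_le hm with rfl | hm
      · rcases prev0 k h1 h2 hp with ⟨hz, hp'⟩ | ⟨hz, hno⟩
        · rw [code_of_isPrev hp']
          simp [hz]
        · rw [code_of_not hno]
          simp [hz]
      · rw [code_of_isPrev (prevV k m h2 hm hp)]
        simp [hm.ne']
    obtain ⟨m, hm, hkm, hkc⟩ := hcode k hk1 hk2
    obtain ⟨m', hm', hlm, hlc⟩ := hcode l hl1 hl2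
    rw [hkc, hlc]
    have hmk := hkm.1
    have hml := hlm.1
    constructor
    · intro heq
      suffices hmm : m = m' by
        subst hmm
        exact ⟨m, hkm, hlm, hm⟩
      by_cases h1 : 0 < z ∧ m = c
      · by_cases h2 : 0 < z ∧ m' = c
        · rw [h1.2, h2.2]
        · have : m' ∈ {x | (0 < z → m' ≠ c) ∧ ∃ j : ℤ, x + j * (b - 1) = m'} :=
            ⟨fun h3 h4 => h2 ⟨h3, h4⟩, 0, by ring⟩
          rw [← heq] at this
          exact absurd h1.2 (this.1 h1.1)
      · have : m ∈ {x | (0 < z → m ≠ c) ∧ ∃ j : ℤ, x + j * (b - 1) = m} :=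
          ⟨fun h3 h4 => h1 ⟨h3, h4⟩, 0, by ring⟩
        rw [heq] at this
        obtain ⟨-, j, hj⟩ := this
        have hj1 : j < 1 := by
          by_contra! hh
          have : 1 * (b - 1) ≤ j * (b - 1) := by gcongr; omega
          omega
        have hj2 : -1 < j := by
          by_contra! hh
          have : j * (b - 1) ≤ -1 * (b - 1) := by gcongr; omega
          omega
        rw [show j = 0 by omega] at hj
        omega
    · rintro ⟨u, h1, h2, -⟩
      rw [hkm.unique h1, hlm.unique h2]
  · intro k h1 h2 h3
    have hp : IsPrev W k (k - 1) := ⟨by omega, h3, fun i _ _ => by omega⟩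
    rcases eq_or_lt_of_le (show c + 1 ≤ k by omega) with rfl | h4
    · rw [add_sub_cancel_right] at hp ⊢
      rw [w0, w2 _ h1 h2, hstep1]
      rcases prev0 _ h1 h2 hp with ⟨hz, hp'⟩ | ⟨hz, hno⟩
      · rw [codeRank_of_isPrev hp', hz]
        push_cast; ring
      · rw [codeRank_of_not hno]
        -- `V` falls into its strict record `c + 1`, so the opening rise there is `z` alone.
        have hs0 : s (c + 1) = 0 := by
          rcases hc with ⟨hz', -⟩ | ⟨-, hc⟩
          · omega
          have h5 := hc c (by omega)
          by_contra hne
          have : b * 1 ≤ b * (s (c + 1) : ℤ) := by gcongr; omega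
          omega
        rw [hs0]
        push_cast; ring
    · rw [codeRank_of_isPrev (prevV k (k - 1) h2 (by omega) hp), w2 k h1 h2,
        w2 (k - 1) (by omega) (by omega), hV k, sub_add_cancel]
      ring

/-- One cut suffices, since it can be moved. The drift over a period is `a - b * z`: for `z = 0` it
is positive and some index is a minimum of everything to its right; for `z > 0` it is negative and
some index lies strictly below everything to its left. -/
theorem isInvariant_code (ha : 0 < a) (hab : a < b) (hcop : IsCoprime a b)
    (hd : 0 < d) {q : ℕ} (hq : 2 ≤ q) (hqd : b - 1 = q * d) (hsd : Function.Periodic s d)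
    (hV : ∀ k, V k = V (k - 1) + (b * s k - a))
    (hsum : (∑ k ∈ Finset.Ioc 0 (b - 1), s k : ℕ) + (z : ℤ) = a) :
    IsInvariant a b d (codeSetoid V (b - 1)) (codeRank V s z) := by
  have hq2 : 2 * d ≤ q * d := by gcongr; exact_mod_cast hq
  have hb : 2 < b := by omega
  have hg : Function.Periodic (fun k => b * (s k : ℤ) - a) d := fun k => by simp only [hsd k]
  have hsn : Function.Periodic s (b - 1) := by
    rw [hqd]; exact hsd.int_mul q
  have hper := add_period hV hg
  have hD : (q : ℤ) * (V d - V 0) = a - b * z := by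
    have h1 := sum_Ioc_of_step (V := V) (c := 0) (k := b - 1) (by omega) fun i _ _ => hV i
    rw [Finset.sum_sub_distrib, ← Finset.mul_sum] at h1
    simp only [Finset.sum_const, Int.card_Ioc, nsmul_eq_mul] at h1
    rw [sub_zero, Int.toNat_of_nonneg (by omega)] at h1
    push_cast at hsum
    rw [show ∑ k ∈ Finset.Ioc 0 (b - 1), (s k : ℤ) = a - z by linarith] at h1
    have h2 := add_mul_period hper 0 q
    rw [zero_add, ← hqd] at h2
    linarith
  have hq0 : (0 : ℤ) < q := by exact_mod_cast (by omega : 0 < q)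
  have hex : ∃ c W, Realizes a b (codeSetoid V (b - 1)) (codeRank V s z) c W := by
    rcases Nat.eq_zero_or_pos z with rfl | hz
    · have hDpos : 0 < V d - V 0 := by
        refine pos_of_mul_pos_right (a := (q : ℤ)) ?_ hq0.le
        rw [hD]; simpa using ha
      obtain ⟨c, hc⟩ := exists_le_of_ge hper hd hDpos
      exact ⟨c, realizes_code hab hb hcop hsn hV hsum (Or.inl ⟨rfl, hc⟩)⟩
    · have hDneg : V d - V 0 < 0 := by
        by_contra! hge
        have h1 : 0 ≤ (q : ℤ) * (V d - V 0) := mul_nonneg hq0.le hge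
        have h2 : b * 1 ≤ b * (z : ℤ) := by gcongr; exact_mod_cast hz
        omega
      obtain ⟨y, hy⟩ := exists_lt_of_lt hper hd hDneg
      refine ⟨y - 1, realizes_code hab hb hcop hsn hV hsum (Or.inr ⟨hz, ?_⟩)⟩
      rwa [sub_add_cancel]
  obtain ⟨c, W, hW⟩ := hex
  have hR : IsRanked a b (codeSetoid V (b - 1)) (codeRank V s z) := isRanked_code hsn hV
  refine ⟨hR, hW.exists_all hR ha hab hb hcop, fun k l => ?_⟩
  simp only [codeSetoid_apply, Set.ext_iff]
  constructor
  · intro h x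
    rw [← code_shift hV hg k x, ← code_shift hV hg l x]
    exact h _
  · intro h x
    have h1 := code_shift (n := b - 1) hV hg k (x - d)
    have h2 := code_shift (n := b - 1) hV hg l (x - d)
    rw [sub_add_cancel] at h1 h2
    rw [h1, h2]
    exact h _

/-- First elements are exactly the `k` with `s k > 0`. At a rise the predecessor is `k - 1`. At a
fall it is some `m` with `k - d ≤ m < k - 1`, making `m + 1` an earlier element of the class, or
there is none, and then `k - d` has none either. -/
theorem isFirst_code (ha : 0 < a) (hab : a < b) (hd : 0 < d) (hdb : 2 * d ≤ b - 1)
    (hsd : Function.Periodic s d) (hV : ∀ k, V k = V (k - 1) + (b * s k - a)) (k : ℤ) :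
    (IsFirst (codeSetoid V (b - 1)) d k → s k = codeRank V s z k) ∧
      (¬ IsFirst (codeSetoid V (b - 1)) d k → s k = 0) := by
  have hg : Function.Periodic (fun k => b * (s k : ℤ) - a) d := fun k => by simp only [hsd k]
  have hper := add_period hV hg
  have hk := hV k
  rcases Nat.eq_zero_or_pos (s k) with h0 | h0
  · refine ⟨fun hf => ?_, fun _ => h0⟩
    exfalso
    rw [h0] at hk
    by_cases hex : ∃ m, IsPrev V k m
    · obtain ⟨m, hm⟩ := hex
      have h1 := hm.le_add hper hd
      have h2 := hm.1
      have h3 : m ≠ k - 1 := by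
        rintro rfl
        have := hm.2.1
        push_cast at hk
        omega
      refine hf (m + 1) (by omega) (by omega) ?_
      rw [codeSetoid_apply, code_of_isPrev hm, code_of_isPrev hm.self_succ]
    · push Not at hex
      refine hf (k - d) le_rfl (by omega) ?_
      rw [codeSetoid_apply, code_of_not hex, code_of_not]
      intro m hm
      have := hm.shift hper
      rw [sub_add_cancel] at this
      exact hex _ this
  · have hlt : V (k - 1) ≤ V k := by
      have : b * 1 ≤ b * (s k : ℤ) := by gcongr <;> omega
      omega
    have hp : IsPrev V k (k - 1) := ⟨by omega, hlt, fun i _ _ => by omega⟩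
    refine ⟨fun _ => by rw [codeRank_of_isPrev hp, sub_add_cancel], fun hf => absurd ?_ hf⟩
    intro i h1 h2 h3
    rw [codeSetoid_apply] at h3
    have hmem : k - 1 ∈ code V (b - 1) k := ⟨0, by simpa using hp⟩
    rw [← h3] at hmem
    obtain ⟨j, hj⟩ := hmem
    have h4 := hj.le_add hper hd
    have h5 := hj.1
    rcases le_or_gt 0 j with hj0 | hj0
    · have : 0 ≤ j * (b - 1) := mul_nonneg hj0 (by omega)
      omega
    · have : j * (b - 1) ≤ -1 * (b - 1) := by gcongr <;> omega
      omega

end Construction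

/-! ### Dyck paths and lasers in terms of walks. -/

open Step

theorem exists_append_of_lt_count {w : List Step} {k : ℕ} (h : k < w.count E) :
    ∃ u v, w = u ++ E :: v ∧ u.count E = k := by
  induction w generalizing k with
  | nil => simp at h
  | cons x w ih =>
    cases x with
    | N =>
      rw [List.count_cons_of_ne (by decide)] at h
      obtain ⟨u, v, rfl, hu⟩ := ih h
      exact ⟨N :: u, v, rfl, by rw [List.count_cons_of_ne (by decide), hu]⟩
    | E =>
      rw [List.count_cons_self] at h
      rcases Nat.eq_zero_or_pos k with rfl | hk
      · exact ⟨[], w, rfl, rfl⟩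
      · obtain ⟨u, v, rfl, hu⟩ := ih (k := k - 1) (by omega)
        exact ⟨E :: u, v, rfl, by rw [List.count_cons_self, hu]; omega⟩

theorem prefix_of_count_lt {u v w : List Step} (hu : u <+: w) (hv : v <+: w)
    (h : u.count E < v.count E) : u <+: v := by
  rcases List.prefix_or_prefix_of_prefix hu hv with h1 | h1
  · exact h1
  · exact absurd (h1.sublist.count_le E) (by omega)

theorem prefix_of_count_lt_succ {u v w : List Step} (hu : u <+: w) (hv : v ++ [E] <+: w)
    (h : u.count E = v.count E) : u <+: v := by
  have h1 := prefix_of_count_lt hu hv (by rw [List.count_append, h]; simp)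
  rw [List.prefix_concat_iff] at h1
  rcases h1 with rfl | h1
  · simp at h
  · exact h1

namespace HasEastStep

variable {w : List Step} {k y : ℕ}

theorem iff_prefix : HasEastStep w k y ↔ ∃ u, u ++ [E] <+: w ∧ u.count E = k ∧ u.count N = y := by
  constructor
  · rintro ⟨u, v, rfl, h1, h2⟩
    exact ⟨u, ⟨v, by simp⟩, h1, h2⟩
  · rintro ⟨u, ⟨v, rfl⟩, h1, h2⟩
    exact ⟨u, v, by simp, h1, h2⟩

theorem lt (h : HasEastStep w k y) : k < w.count E := by
  obtain ⟨u, v, rfl, rfl, -⟩ := h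
  simp

theorem le (h : HasEastStep w k y) : y ≤ w.count N := by
  obtain ⟨u, v, rfl, -, rfl⟩ := h
  simp

theorem unique {y' : ℕ} (h : HasEastStep w k y) (h' : HasEastStep w k y') : y = y' := by
  rw [iff_prefix] at h h'
  obtain ⟨u, hu, h1, rfl⟩ := h
  obtain ⟨v, hv, h2, rfl⟩ := h'
  have e1 := prefix_of_count_lt_succ ((List.prefix_append u [E]).trans hu) hv (by omega)
  have e2 := prefix_of_count_lt_succ ((List.prefix_append v [E]).trans hv) hu (by omega)
  exact le_antisymm (e1.sublist.count_le N) (e2.sublist.count_le N)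

theorem mono {y' : ℕ} (h : HasEastStep w k y) (h' : HasEastStep w (k + 1) y') : y ≤ y' := by
  rw [iff_prefix] at h h'
  obtain ⟨u, hu, h1, rfl⟩ := h
  obtain ⟨v, hv, h2, rfl⟩ := h'
  have e1 := prefix_of_count_lt_succ hu hv (by rw [List.count_append, h1, h2]; simp)
  have := e1.sublist.count_le N
  rw [List.count_append] at this
  omega

theorem append (h : HasEastStep w k y) (v : List Step) : HasEastStep (w ++ v) k y := by
  rw [iff_prefix] at h ⊢
  obtain ⟨u, hu, h1⟩ := h
  exact ⟨u, hu.trans (List.prefix_append w v), h1⟩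

end HasEastStep

theorem exists_hasEastStep {w : List Step} {k : ℕ} (h : k < w.count E) : ∃ y, HasEastStep w k y := by
  obtain ⟨u, v, h1, h2⟩ := exists_append_of_lt_count h
  exact ⟨_, u, v, h1, h2, rfl⟩

theorem HasValley.hasEastStep {w : List Step} {i h : ℕ} (hv : HasValley w i h) :
    1 ≤ i ∧ HasEastStep w (i - 1) h := by
  obtain ⟨u, v, rfl, rfl, rfl⟩ := hv
  refine ⟨by simp, u, N :: v, rfl, by simp, by simp⟩

theorem hasValley_iff_lt {w : List Step} {i h h' : ℕ} (h1 : HasEastStep w i h)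
    (h2 : HasEastStep w (i + 1) h') : HasValley w (i + 1) h ↔ h < h' := by
  constructor
  · rintro ⟨u, v, hw, hx, rfl⟩
    rw [HasEastStep.iff_prefix] at h2
    obtain ⟨u', hu', hx', rfl⟩ := h2
    have e1 : u ++ [E] ++ [N] <+: w := ⟨v, by rw [hw]; simp⟩
    have e2 := prefix_of_count_lt_succ e1 hu' (by
      rw [List.count_append, hx, hx']; simp)
    have := e2.sublist.count_le N
    rw [List.count_append] at this
    simp only [List.count_singleton_self] at this
    omega
  · intro hlt
    obtain ⟨u, v, rfl, hx, hy⟩ := h1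
    have hlt' := h2.lt
    rcases v with _ | ⟨x, v⟩
    · simp at hlt'; omega
    cases x with
    | N => exact ⟨u, v, rfl, by simp [hx], by simp [hy]⟩
    | E =>
      have : HasEastStep (u ++ E :: E :: v) (i + 1) h :=
        ⟨u ++ [E], v, by simp, by simp [hx], by simp [hy]⟩
      have := this.unique h2
      omega

theorem HasValley.lt {a b : ℕ} {w : List Step} {i h : ℕ} (hw : IsDyckPath a b w) (hb : 0 < b)
    (hv : HasValley w i h) : i < b := by
  obtain ⟨u, v, rfl, hx, hy⟩ := hv
  obtain ⟨h1, h2, h3⟩ := hw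
  have h4 := h3 (u ++ [E]) ⟨N :: v, by simp⟩
  have h5 : (u ++ [E]).count N + 1 ≤ a := by
    rw [← h1]; simp
  have h6 : i ≤ b := by
    rw [← hx, ← h2]; simp
  rcases Nat.lt_or_ge i b with hlt | hge
  · exact hlt
  · rw [hx, show i = b by omega, mul_comm] at h4
    have := Nat.le_of_mul_le_mul_left h4 hb
    omega

section Walk

variable {a b : ℕ} {w : List Step} {W : ℤ → ℤ}

/-- Every Dyck path has a walk. -/
theorem IsDyckPath.exists_isWalk (hw : IsDyckPath a b w) (hb : 0 < b) (hcop : Nat.Coprime a b) :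
    ∃ W, IsWalk a b 0 W ∧ ∀ k y : ℕ, HasEastStep w k y → W (k + 1) = b * y - a * (k + 1) := by
  obtain ⟨hN, hE, hpre⟩ := hw
  have hex : ∀ k : ℕ, ∃ y, k < b → HasEastStep w k y := by
    intro k
    by_cases hk : k < b
    · obtain ⟨y, hy⟩ := exists_hasEastStep (w := w) (k := k) (by omega)
      exact ⟨y, fun _ => hy⟩
    · exact ⟨0, fun h => absurd h hk⟩
  choose H hH using hex
  have hle : ∀ k, k < b → a * (k + 1) ≤ b * H k := by
    intro k hk
    obtain ⟨u, v, h1, h2, h3⟩ := hH k hk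
    have := hpre (u ++ [E]) ⟨v, by rw [h1]; simp⟩
    simpa [h2, h3] using this
  -- No east step ends at abscissa `0`, so the starting value is set separately.
  set W : ℤ → ℤ := fun k => if k ≤ 0 then 0 else b * (H (k - 1).toNat : ℤ) - a * k with hW
  have w0 : W 0 = 0 := by simp [hW]
  have w1 : ∀ k : ℕ, W (k + 1) = b * H k - a * (k + 1) := by
    intro k
    simp only [hW]
    rw [if_neg (by omega), add_sub_cancel_right, Int.toNat_natCast]
  refine ⟨W, ⟨w0, ?_, fun k h1 h2 => ?_, fun k h1 h2 => ?_⟩, fun k y hy => ?_⟩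
  · obtain ⟨n, rfl⟩ : ∃ n, b = n + 1 := ⟨b - 1, by omega⟩
    have h1 := w1 n
    push_cast
    rw [zero_add, h1]
    have h2 := (hH n (by omega)).le
    have h3 : a ≤ H n := Nat.le_of_mul_le_mul_left (by rw [mul_comm]; exact hle n (by omega)) hb
    rw [show H n = a by omega]
    push_cast; ring
  · obtain ⟨n, rfl⟩ : ∃ n : ℕ, k = n + 1 := ⟨(k - 1).toNat, by omega⟩
    rw [w1]
    have h3 := hle n (by omega)
    have h4 : a * (n + 1) ≠ b * H n := by
      intro heq
      have h5 : b ∣ n + 1 := hcop.symm.dvd_of_dvd_mul_left ⟨_, heq⟩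
      have := Nat.le_of_dvd (by omega) h5
      omega
    have h5 : a * (n + 1) < b * H n := by omega
    have h6 : (a : ℤ) * (n + 1) < b * H n := by exact_mod_cast h5
    omega
  · obtain ⟨n, rfl⟩ : ∃ n : ℕ, k = n + 1 := ⟨(k - 1).toNat, by omega⟩
    rw [w1, add_sub_cancel_right]
    rcases n with _ | n
    · refine ⟨H 0, ?_⟩
      push_cast
      rw [w0]; ring
    · have h3 := (hH n (by omega)).mono (hH (n + 1) (by omega))
      refine ⟨H (n + 1) - H n, ?_⟩
      have h4 := w1 n
      push_cast [h3] at h4 ⊢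
      rw [h4]; ring
  · have h1 := hy.lt
    rw [w1, (hH k (by omega)).unique hy]

/-- The lattice path with `r i` north steps at abscissa `i`. -/
def pathOf (r : ℕ → ℕ) : ℕ → List Step
  | 0 => []
  | n + 1 => pathOf r n ++ List.replicate (r n) N ++ [E]

theorem count_E_pathOf (r : ℕ → ℕ) (n : ℕ) : (pathOf r n).count E = n := by
  induction n with
  | zero => rfl
  | succ n ih => simp [pathOf, ih, List.count_replicate]

theorem count_N_pathOf (r : ℕ → ℕ) (n : ℕ) : (pathOf r n).count N = ∑ i ∈ Finset.range n, r i := by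
  induction n with
  | zero => rfl
  | succ n ih => simp [pathOf, ih, Finset.sum_range_succ]

theorem hasEastStep_pathOf (r : ℕ → ℕ) {n k : ℕ} (h : k < n) :
    HasEastStep (pathOf r n) k (∑ i ∈ Finset.range (k + 1), r i) := by
  induction n with
  | zero => omega
  | succ n ih =>
    rcases eq_or_lt_of_le (Nat.le_of_lt_succ h) with rfl | h
    · refine ⟨pathOf r k ++ List.replicate (r k) N, [], rfl, ?_, ?_⟩
      · simp [count_E_pathOf, List.count_replicate]
      · simp [count_N_pathOf, Finset.sum_range_succ]
    · rw [pathOf, List.append_assoc]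
      exact (ih h).append _

/-- Every walk is the walk of a Dyck path. -/
theorem IsWalk.exists_isDyckPath (hW : IsWalk a b 0 W) (hb : 0 < b) :
    ∃ w, IsDyckPath a b w ∧ ∀ k y : ℕ, HasEastStep w k y → W (k + 1) = b * y - a * (k + 1) := by
  have hex : ∀ k : ℕ, ∃ r : ℕ, k < b → W (k + 1) = W k - a + b * r := by
    intro k
    by_cases hk : k < b
    · obtain ⟨r, hr⟩ := hW.step (k + 1) (by omega) (by omega)
      rw [add_sub_cancel_right] at hr
      exact ⟨r, fun _ => hr⟩
    · exact ⟨0, fun h => absurd h hk⟩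
  choose r hr using hex
  have hsum : ∀ k : ℕ, k ≤ b → W k = b * (∑ i ∈ Finset.range k, r i : ℕ) - a * k := by
    intro k
    induction k with
    | zero => intro _; simp [hW.start]
    | succ k ih =>
      intro hk
      push_cast
      rw [hr k (by omega), ih (by omega), Finset.sum_range_succ]
      push_cast; ring
  have hstep : ∀ k y : ℕ, HasEastStep (pathOf r b) k y → W (k + 1) = b * y - a * (k + 1) := by
    intro k y hy
    have h1 := hy.lt
    rw [count_E_pathOf] at h1
    have h2 := hsum (k + 1) (by omega)
    rw [(hasEastStep_pathOf r h1).unique hy] at h2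
    exact_mod_cast h2
  refine ⟨pathOf r b, ⟨?_, count_E_pathOf r b, fun u hu => ?_⟩, hstep⟩
  · rw [count_N_pathOf]
    have h1 := hsum b le_rfl
    have h2 := hW.finish
    rw [zero_add] at h2
    rw [h2] at h1
    have h3 : (b : ℤ) * (∑ i ∈ Finset.range b, r i : ℕ) = b * a := by linarith
    exact_mod_cast mul_left_cancel₀ (by omega) h3
  · rcases Nat.eq_zero_or_pos (u.count E) with h0 | h0
    · rw [h0]; simp
    obtain ⟨u₁, u₂, rfl, h2⟩ := exists_append_of_lt_count (w := u) (k := u.count E - 1) (by omega)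
    obtain ⟨v, hv⟩ := hu
    have h3 : HasEastStep (pathOf r b) (u₁.count E) (u₁.count N) :=
      ⟨u₁, u₂ ++ v, by rw [← hv]; simp, rfl, rfl⟩
    have h4 := hstep _ _ h3
    have h5 := h3.lt
    rw [count_E_pathOf] at h5
    have h6 := hW.nonneg (k := u₁.count E + 1) (by omega) (by omega)
    rw [h4] at h6
    have h7 : a * (u₁.count E + 1) ≤ b * u₁.count N := by
      have : (a : ℤ) * (u₁.count E + 1) ≤ b * u₁.count N := by omega
      exact_mod_cast this
    have h8 : (u₁ ++ E :: u₂).count E = u₁.count E + 1 := by omega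
    rw [h8]
    refine h7.trans (Nat.mul_le_mul_left b ?_)
    simp

/-- In these coordinates the ray is the level `W i`, and the east step descends from `W (j + 1) + a`
to `W (j + 1)`. -/
theorem rayCrosses_iff (hE : w.count E = b) (hb : 0 < b)
    (hh : ∀ k y : ℕ, HasEastStep w k y → W (k + 1) = b * y - a * (k + 1)) {i h j : ℕ}
    (hi : W i = b * h - a * i) :
    RayCrosses a b w i h j ↔ i ≤ j ∧ j < b ∧ W i < W (j + 1) + a ∧ W (j + 1) < W i := by
  have hbQ : (0 : ℚ) < b := by exact_mod_cast hb
  have key : ∀ x y : ℕ, (lineHeight a b i h x < y ↔ W i < b * y - a * x) ∧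
      ((y : ℚ) < lineHeight a b i h x ↔ (b * y - a * x : ℤ) < W i) := by
    intro x y
    have e : (b : ℚ) * lineHeight a b i h x = b * h + a * (x - i) := by
      unfold lineHeight; field_simp
    rw [hi]
    constructor
    · rw [← mul_lt_mul_iff_right₀ hbQ, e, ← Int.cast_lt (R := ℚ)]
      push_cast
      constructor <;> intro _ <;> linarith
    · rw [← mul_lt_mul_iff_right₀ hbQ, e, ← Int.cast_lt (R := ℚ)]
      push_cast
      constructor <;> intro _ <;> linarith
  unfold RayCrosses
  constructor
  · rintro ⟨h1, y, h2, h3, h4⟩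
    have h5 := hh j y h2
    have h6 := (key j y).1.1 h3
    have h7 := (key (j + 1) y).2.1 (by exact_mod_cast h4)
    push_cast at h7
    exact ⟨h1, hE ▸ h2.lt, by rw [h5]; linarith, by rw [h5]; linarith⟩
  · rintro ⟨h1, h2, h3, h4⟩
    obtain ⟨y, hy⟩ := exists_hasEastStep (w := w) (k := j) (by omega)
    rw [hh j y hy] at h3 h4
    refine ⟨h1, y, hy, (key j y).1.2 (by linarith), ?_⟩
    have := (key (j + 1) y).2.2 (by push_cast; linarith)
    exact_mod_cast this

/-- A step falls by at most `a`, and earlier values differ from `W i` by coprimality. So the walk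
first falls below the level `W i` through the interior of an east step. -/
theorem IsWalk.lt_add_of_drop (hW : IsWalk a b 0 W) (hcop : Nat.Coprime a b)
    (hb : 0 < b) {i m : ℕ} (h2 : i < m) (h3 : m ≤ b) (h4 : W i < W (i + 1))
    (hlow : ∀ t : ℕ, i ≤ t → t < m → W i ≤ W t) : W i < W m + a := by
  have hs := hW.sub_le (k := m) (by omega) (by omega) (by omega)
  obtain ⟨m, rfl⟩ : ∃ n, m = n + 1 := ⟨m - 1, by omega⟩
  have h5 := hlow m (by omega) (by omega)
  push_cast at hs ⊢
  rw [add_sub_cancel_right] at hs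
  rcases eq_or_lt_of_le (show i ≤ m by omega) with rfl | hlt
  · omega
  · have := hW.ne (Nat.isCoprime_iff_coprime.2 hcop) (i := i) (j := m) (by omega) (by omega)
      (by omega)
    omega

theorem mem_laserSet_iff (hw : IsDyckPath a b w) (hW : IsWalk a b 0 W) (ha : 0 < a) (hab : a < b)
    (hcop : Nat.Coprime a b)
    (hh : ∀ k y : ℕ, HasEastStep w k y → W (k + 1) = b * y - a * (k + 1)) {i j : ℕ} :
    (i, j) ∈ laserSet a b w ↔ 1 ≤ i ∧ i ≤ j ∧ j < b ∧ W i < W (i + 1) ∧ W (j + 1) < W i ∧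
      ∀ m : ℕ, i ≤ m → m ≤ j → W i ≤ W m := by
  have hb : 0 < b := by omega
  have hval : ∀ n h h' : ℕ, HasEastStep w n h → HasEastStep w (n + 1) h' →
      (h < h' ↔ W (n + 1) < W (n + 1 + 1)) := by
    intro n h h' h1 h2
    have e1 := hh _ _ h1
    have e2 := hh _ _ h2
    push_cast at e2
    rw [e1, e2]
    constructor
    · intro hlt
      have : (b : ℤ) * (h + 1) ≤ b * h' := by gcongr; exact_mod_cast hlt
      linarith
    · intro hlt
      by_contra! hle
      have : (b : ℤ) * h' ≤ b * h := by gcongr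
      linarith
  constructor
  · rintro ⟨h, hv, hr, hno⟩
    obtain ⟨hi1, hi2⟩ := hv.hasEastStep
    have hib := hv.lt hw hb
    obtain ⟨n, rfl⟩ : ∃ n, i = n + 1 := ⟨i - 1, by omega⟩
    rw [Nat.add_sub_cancel] at hi2
    have hWi : W ((n + 1 : ℕ) : ℤ) = b * h - a * ((n + 1 : ℕ) : ℤ) := by
      push_cast; exact hh n h hi2
    obtain ⟨h', hh'⟩ := exists_hasEastStep (w := w) (k := n + 1) (by rw [hw.2.1]; exact hib)
    have hlt := (hval n h h' hi2 hh').1 ((hasValley_iff_lt hi2 hh').1 hv)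
    rw [rayCrosses_iff hw.2.1 hb hh hWi] at hr
    refine ⟨hi1, hr.1, hr.2.1, by exact_mod_cast hlt, hr.2.2.2, ?_⟩
    intro m
    induction m using Nat.strong_induction_on with
    | _ m ih =>
      intro hm1 hm2
      by_contra! hlt'
      have hm3 : n + 1 < m := by
        rcases eq_or_lt_of_le hm1 with rfl | hm1
        · omega
        · exact hm1
      obtain ⟨m', rfl⟩ : ∃ m', m = m' + 1 := ⟨m - 1, by omega⟩
      refine hno m' (by simp only at *; omega) ((rayCrosses_iff hw.2.1 hb hh hWi).2
        ⟨by omega, by omega, ?_, by exact_mod_cast hlt'⟩)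
      have := hW.lt_add_of_drop hcop hb hm3 (by omega) (by exact_mod_cast hlt)
        fun t ht1 ht2 => ih t (by omega) ht1 (by omega)
      exact_mod_cast this
  · rintro ⟨hi, hij, hj, hlt, hdrop, hlow⟩
    obtain ⟨n, rfl⟩ : ∃ n, i = n + 1 := ⟨i - 1, by omega⟩
    obtain ⟨h, h1⟩ := exists_hasEastStep (w := w) (k := n) (by rw [hw.2.1]; omega)
    obtain ⟨h', h2⟩ := exists_hasEastStep (w := w) (k := n + 1) (by rw [hw.2.1]; omega)
    have hWi : W ((n + 1 : ℕ) : ℤ) = b * h - a * ((n + 1 : ℕ) : ℤ) := by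
      push_cast; exact hh n h h1
    refine ⟨h, (hasValley_iff_lt h1 h2).2 ((hval n h h' h1 h2).2 (by exact_mod_cast hlt)),
      (rayCrosses_iff hw.2.1 hb hh hWi).2 ⟨hij, hj, ?_, hdrop⟩, fun j' hj' hr => ?_⟩
    · have := hW.lt_add_of_drop hcop hb (i := n + 1) (m := j + 1) (by omega) (by omega) hlt
        fun t ht1 ht2 => hlow t ht1 (by omega)
      exact_mod_cast this
    · rw [rayCrosses_iff hw.2.1 hb hh hWi] at hr
      have := hlow (j' + 1) (by omega) (by simp only at hj'; omega)
      push_cast at this hr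
      omega

/-- Two labels are in the same block iff they have the same predecessor in the walk. -/
theorem partitionOf_iff (hw : IsDyckPath a b w) (hW : IsWalk a b 0 W) (ha : 0 < a) (hab : a < b)
    (hcop : Nat.Coprime a b)
    (hh : ∀ k y : ℕ, HasEastStep w k y → W (k + 1) = b * y - a * (k + 1)) {k l : ℕ}
    (hk0 : 0 < k) (hk : k < b) (hl0 : 0 < l) (hl : l < b) :
    (∀ p ∈ laserSet a b w, (LaserCutsOff p k ↔ LaserCutsOff p l)) ↔
      ∃ m, IsPrev W k m ∧ IsPrev W l m ∧ 0 ≤ m := by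
  -- The end `j` drops out: the laser from `i` cuts off `k > i` iff the walk stays at or above `W i`
  -- up to `k`.
  have hcut : ∀ {i j k : ℕ}, (i, j) ∈ laserSet a b w → (LaserCutsOff (i, j) k ↔
      i < k ∧ ∀ m : ℕ, i ≤ m → m ≤ k → W i ≤ W m) := by
    intro i j k hp
    rw [mem_laserSet_iff hw hW ha hab hcop hh] at hp
    obtain ⟨h1, h2, h3, h4, h5, h6⟩ := hp
    refine and_congr_right fun hik => ⟨fun hkj m hm1 hm2 => h6 m hm1 (hm2.trans hkj), fun hm => ?_⟩
    by_contra! hlt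
    have := hm (j + 1) (by omega) hlt
    push_cast at this
    omega
  have hex : ∀ i : ℕ, 1 ≤ i → i < b → W i < W (i + 1) → ∃ j, (i, j) ∈ laserSet a b w := by
    intro i hi hib hlt
    have hfinish := hW.finish
    rw [zero_add] at hfinish
    have hpos := hW.pos i (by omega) (by omega)
    have hP : ∃ j : ℕ, i ≤ j ∧ W (j + 1) < W i :=
      ⟨b - 1, by omega, by push_cast [show 1 ≤ b by omega]; rw [sub_add_cancel, hfinish]; exact hpos⟩
    classical
    obtain ⟨h1, h2⟩ := Nat.find_spec hP
    refine ⟨Nat.find hP, (mem_laserSet_iff hw hW ha hab hcop hh).2 ⟨hi, h1, ?_, hlt, h2, ?_⟩⟩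
    · have : Nat.find hP ≤ b - 1 := Nat.find_min' hP
        ⟨by omega, by push_cast [show 1 ≤ b by omega]; rw [sub_add_cancel, hfinish]; exact hpos⟩
      omega
    · intro m hm1 hm2
      rcases eq_or_lt_of_le hm1 with rfl | hm1
      · exact le_rfl
      obtain ⟨m, rfl⟩ : ∃ n, m = n + 1 := ⟨m - 1, by omega⟩
      have := Nat.find_min hP (m := m) (by omega)
      by_contra! hlt'
      exact this ⟨by omega, by exact_mod_cast hlt'⟩
  -- A positive predecessor `m` of `k` is a valley whose laser cuts off `k`. If that laser also cuts
  -- off `l`, then `W m ≤ W l`, so `m` is at most the predecessor of `l`.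
  have hle : ∀ {k l : ℕ} {m m' : ℤ}, k < b → 0 < l → l < b → 0 ≤ m' → IsPrev W k m →
      IsPrev W l m' → (∀ p ∈ laserSet a b w, (LaserCutsOff p k → LaserCutsOff p l)) →
      m ≤ m' := by
    intro k l m m' hk hl0 hl hm' hkm hlm hp
    rcases le_or_gt m 0 with hm | hm
    · omega
    have hmk := hkm.1
    obtain ⟨i, rfl⟩ : ∃ i : ℕ, m = i := ⟨m.toNat, by omega⟩
    have hs := hW.lt_of_le (by exact_mod_cast ha) (by exact_mod_cast hab) (k := i + 1) (by omega)
      (by omega) (by rw [add_sub_cancel_right]; exact hkm.self_succ.2.1)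
    rw [add_sub_cancel_right] at hs
    obtain ⟨j, hj⟩ := hex i (by omega) (by omega) hs
    have h1 : LaserCutsOff (i, j) k := by
      refine (hcut hj).2 ⟨by omega, fun t ht1 ht2 => ?_⟩
      rcases eq_or_lt_of_le ht1 with rfl | ht1
      · exact le_rfl
      rcases eq_or_lt_of_le ht2 with rfl | ht2
      · exact hkm.2.1
      exact hkm.2.1.trans (hkm.2.2 t (by omega) (by omega)).le
    have h2 := (hcut hj).1 (hp _ hj h1)
    exact hlm.le_of_le (by omega) (h2.2 l (by omega) le_rfl)
  have hcuts : ∀ {k l : ℕ} {m : ℤ}, IsPrev W k m → IsPrev W l m → ∀ p ∈ laserSet a b w,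
      LaserCutsOff p k → LaserCutsOff p l := by
    rintro k l m hkm hlm ⟨i, j⟩ hp hc
    rw [hcut hp] at hc ⊢
    have him := hkm.le_of_le (by omega) (hc.2 k (by omega) le_rfl)
    have hml := hlm.1
    have hmk := hkm.1
    obtain ⟨m, rfl⟩ : ∃ i : ℕ, m = i := ⟨m.toNat, by omega⟩
    have h3 := hc.2 m (by omega) (by omega)
    refine ⟨by omega, fun t ht1 ht2 => ?_⟩
    rcases le_or_gt t m with htm | htm
    · exact hc.2 t ht1 (by omega)
    rcases eq_or_lt_of_le ht2 with rfl | ht2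
    · exact h3.trans hlm.2.1
    · exact h3.trans (hlm.2.1.trans (hlm.2.2 t (by omega) (by omega)).le)
  constructor
  · intro hp
    obtain ⟨m, hm, hkm⟩ := hW.exists_isPrev (k := k) (by omega) (by omega)
    obtain ⟨m', hm', hlm⟩ := hW.exists_isPrev (k := l) (by omega) (by omega)
    have e1 := hle hk hl0 hl hm' hkm hlm fun p hp' => (hp p hp').1
    have e2 := hle hl hk0 hk hm hlm hkm fun p hp' => (hp p hp').2
    obtain rfl : m = m' := le_antisymm e1 e2
    exact ⟨m, hkm, hlm, hm⟩
  · rintro ⟨m, hkm, hlm, -⟩ p hp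
    exact ⟨hcuts hkm hlm p hp, hcuts hlm hkm p hp⟩

end Walk


/-! ### Partitions of `Fin n` as periodic partitions of `ℤ`. -/

/-- The residue class of the label `x`, as an element of `Fin n`. -/
def toFin (n : ℕ) [NeZero n] (x : ℤ) : Fin n :=
  ⟨((x - 1) % n).toNat, by
    have h := NeZero.pos n
    have h1 := Int.emod_lt_of_pos (x - 1) (b := n) (by omega)
    have h2 := Int.emod_nonneg (x - 1) (b := n) (by omega)
    omega⟩

section ToFin

variable {n : ℕ} [NeZero n]

theorem toFin_val (x : ℤ) : ((toFin n x : ℕ) : ℤ) = (x - 1) % n :=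
  Int.toNat_of_nonneg (Int.emod_nonneg _ (by exact_mod_cast NeZero.ne n))

theorem toFin_add_one (i : Fin n) : toFin n ((i : ℕ) + 1) = i := by
  apply Fin.ext
  have h := toFin_val (n := n) ((i : ℕ) + 1)
  rw [add_sub_cancel_right, Int.emod_eq_of_lt (by omega) (by exact_mod_cast i.2)] at h
  exact_mod_cast h

theorem toFin_val_of_lt {x : ℤ} (h1 : 0 < x) (h2 : x < n + 1) :
    ((toFin n x : ℕ) : ℤ) = x - 1 := by
  rw [toFin_val, Int.emod_eq_of_lt (by omega) (by omega)]

theorem toFin_periodic : Function.Periodic (toFin n) (n : ℤ) := by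
  intro x
  apply Fin.ext
  have h1 := toFin_val (n := n) (x + n)
  have h2 := toFin_val (n := n) x
  rw [show x + n - 1 = x - 1 + n by ring, Int.add_emod_right] at h1
  omega

theorem eq_toFin_add (x : ℤ) : x = (toFin n x : ℕ) + 1 + (x - 1) / n * n := by
  have := Int.emod_add_mul_ediv (x - 1) n
  rw [toFin_val]
  linarith

theorem toFin_succ (x : ℤ) : toFin n (x + 1) = finRotate n (toFin n x) := by
  obtain ⟨m, rfl⟩ : ∃ m, n = m + 1 := ⟨n - 1, by have := NeZero.pos n; omega⟩
  rw [finRotate_apply]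
  apply Fin.ext
  rw [Fin.val_add_one]
  have h1 := toFin_val (n := m + 1) (x + 1)
  have h2 := toFin_val (n := m + 1) x
  have h3 : (x + 1 - 1) % ((m + 1 : ℕ) : ℤ) = (((x - 1) % ((m + 1 : ℕ) : ℤ)) + 1) % ((m + 1 : ℕ) : ℤ) := by
    rw [Int.emod_add_emod]; congr 1; ring
  rw [h3, ← h2] at h1
  have h4 := (toFin (m + 1) x).2
  split_ifs with hl
  · rw [hl] at h1
    simpa using h1
  · have h5 : (toFin (m + 1) x : ℕ) ≠ m := fun h => hl (Fin.ext (by simpa using h))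
    rw [Int.emod_eq_of_lt (by omega) (by omega)] at h1
    exact_mod_cast h1

theorem sum_toFin (t : Fin n → ℕ) :
    ∑ k ∈ Finset.Ioc 0 (n : ℤ), t (toFin n k) = ∑ i, t i := by
  refine Finset.sum_bij' (fun k _ => toFin n k) (fun i _ => ((i : ℕ) : ℤ) + 1)
    (fun _ _ => Finset.mem_univ _) (fun i _ => ?_) (fun k hk => ?_) (fun i _ => toFin_add_one i)
    (fun _ _ => rfl)
  · have := i.2
    simp only [Finset.mem_Ioc]
    omega
  · rw [Finset.mem_Ioc] at hk
    rw [toFin_val_of_lt hk.1 (by omega)]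
    ring

theorem apply_toFin {M : Type*} {s : ℤ → M} (hs : Function.Periodic s (n : ℤ)) (k : ℤ) :
    s ((toFin n k : ℕ) + 1) = s k := by
  conv_rhs => rw [eq_toFin_add (n := n) k]
  exact (hs.int_mul _ _).symm

/-- The periodic partition of `ℤ` given by a partition of `Fin n`. -/
def lift (π : Setoid (Fin n)) : Setoid ℤ := Setoid.comap (toFin n) π

theorem lift_apply {π : Setoid (Fin n)} {x y : ℤ} :
    lift π x y ↔ π (toFin n x) (toFin n y) := Iff.rfl

theorem lift_injective : Function.Injective (lift (n := n)) := by
  intro π π' h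
  ext i j
  have := Setoid.ext_iff.1 h ((i : ℕ) + 1) ((j : ℕ) + 1)
  rwa [lift_apply, lift_apply, toFin_add_one, toFin_add_one] at this

theorem lift_rot (π : Setoid (Fin n)) (x y : ℤ) : lift (rot π) (x + 1) (y + 1) ↔ lift π x y := by
  rw [lift_apply, lift_apply, toFin_succ, toFin_succ]
  change π ((finRotate n).symm _) ((finRotate n).symm _) ↔ _
  rw [Equiv.symm_apply_apply, Equiv.symm_apply_apply]

theorem lift_rot_iterate (π : Setoid (Fin n)) (d : ℕ) (x y : ℤ) :
    lift (rot^[d] π) (x + d) (y + d) ↔ lift π x y := by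
  induction d with
  | zero => simp only [Nat.cast_zero, add_zero]; exact Iff.rfl
  | succ d ih =>
    rw [Function.iterate_succ_apply', ← ih]
    push_cast
    rw [← add_assoc, ← add_assoc, lift_rot]

theorem rot_iterate_eq_iff (π : Setoid (Fin n)) (d : ℕ) :
    rot^[d] π = π ↔ ∀ x y, lift π (x + d) (y + d) ↔ lift π x y := by
  constructor
  · intro h x y
    conv_lhs => rw [← h]
    exact lift_rot_iterate π d x y
  · intro h
    apply lift_injective
    ext x y
    have h1 := lift_rot_iterate π d (x - d) (y - d)
    have h2 := h (x - d) (y - d)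
    rw [sub_add_cancel, sub_add_cancel] at h1 h2
    rw [h1, h2]

end ToFin

theorem mem_NC_iff {a b : ℕ} [NeZero (b - 1)] (ha : 0 < a) (hab : a < b)
    (hcop : Nat.Coprime a b) (π : Setoid (Fin (b - 1))) :
    π ∈ NC a b ↔ ∃ W, IsWalk a b 0 W ∧ ∀ k l : ℤ, 0 < k → k < b → 0 < l → l < b →
      (lift π k l ↔ ∃ m, IsPrev W k m ∧ IsPrev W l m ∧ 0 ≤ m) := by
  have hb : 0 < b := by omega
  have hn : ((b - 1 : ℕ) : ℤ) + 1 = b := by omega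
  have hlab : ∀ k : ℤ, 0 < k → k < b → ((label (toFin (b - 1) k) : ℕ) : ℤ) = k := by
    intro k h1 h2
    have := toFin_val_of_lt (n := b - 1) h1 (by omega)
    simp only [label]
    push_cast
    omega
  have hlt : ∀ i : Fin (b - 1), 0 < label i ∧ label i < b := by
    intro i
    have := i.2
    simp only [label]
    omega
  constructor
  · rintro ⟨w, hw, rfl⟩
    obtain ⟨W, hW, hh⟩ := hw.exists_isWalk hb hcop
    refine ⟨W, hW, fun k l hk1 hk2 hl1 hl2 => ?_⟩
    have := partitionOf_iff hw hW ha hab hcop hh (hlt (toFin (b - 1) k)).1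
      (hlt (toFin (b - 1) k)).2 (hlt (toFin (b - 1) l)).1 (hlt (toFin (b - 1) l)).2
    rw [hlab k hk1 hk2, hlab l hl1 hl2] at this
    exact this
  · rintro ⟨W, hW, hrel⟩
    obtain ⟨w, hw, hh⟩ := hW.exists_isDyckPath hb
    refine ⟨w, hw, ?_⟩
    ext i j
    have h1 := partitionOf_iff hw hW ha hab hcop hh (hlt i).1 (hlt i).2 (hlt j).1 (hlt j).2
    have h2 := hrel (label i) (label j) (by have := (hlt i).1; omega)
      (by have := (hlt i).2; omega) (by have := (hlt j).1; omega) (by have := (hlt j).2; omega)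
    rw [lift_apply, show ((label i : ℕ) : ℤ) = (i : ℕ) + 1 by simp [label],
      show ((label j : ℕ) : ℤ) = (j : ℕ) + 1 by simp [label], toFin_add_one, toFin_add_one] at h2
    rw [h2]
    rw [show ((label i : ℕ) : ℤ) = (i : ℕ) + 1 by simp [label],
      show ((label j : ℕ) : ℤ) = (j : ℕ) + 1 by simp [label]] at h1
    exact h1

/-- The rotation invariant noncrossing partitions are the invariant ranked partitions of `ℤ`. -/
theorem mem_NC_and_rot_iff {a b d : ℕ} [NeZero (b - 1)] (ha : 0 < a) (hab : a < b) (hb : 2 < b)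
    (hcop : Nat.Coprime a b) (π : Setoid (Fin (b - 1))) :
    π ∈ NC a b ∧ rot^[d] π = π ↔ ∃ ρ, IsInvariant a b d (lift π) ρ := by
  have hn : ((b - 1 : ℕ) : ℤ) = b - 1 := by omega
  rw [mem_NC_iff ha hab hcop, rot_iterate_eq_iff]
  constructor
  · rintro ⟨⟨W, hW, hrel⟩, hrot⟩
    -- The rank is read off at `m + 1`, the leftmost label of the block, so it depends only on the
    -- block.
    have hex : ∀ k : ℤ, ∃ r : ℕ, 0 < k → k < b →
        ∃ m, 0 ≤ m ∧ IsPrev W k m ∧ W (m + 1) = W m - a + b * r := by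
      intro k
      by_cases hk : 0 < k ∧ k < b
      · obtain ⟨m, hm, hp⟩ := hW.exists_isPrev (k := k) hk.1 (by omega)
        have := hp.1
        obtain ⟨r, hr⟩ := hW.step (m + 1) (by omega) (by omega)
        rw [add_sub_cancel_right] at hr
        exact ⟨r, fun _ _ => ⟨m, hm, hp, hr⟩⟩
      · exact ⟨0, fun h1 h2 => absurd ⟨h1, h2⟩ hk⟩
    choose r hr using hex
    set ρ : ℤ → ℕ := fun x => r ((toFin (b - 1) x : ℕ) + 1)
    have hρ : ∀ k : ℤ, 0 < k → k < b → ρ k = r k := by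
      intro k h1 h2
      simp only [ρ]
      rw [toFin_val_of_lt h1 (by omega), sub_add_cancel]
    have hR : IsRanked a b (lift π) ρ := by
      constructor
      · intro k
        rw [lift_apply, ← hn, toFin_periodic k]
      · intro k l hkl
        have hk := (toFin (b - 1) k).2
        have hl := (toFin (b - 1) l).2
        have h1 : lift π ((toFin (b - 1) k : ℕ) + 1) ((toFin (b - 1) l : ℕ) + 1) := by
          rw [lift_apply, toFin_add_one, toFin_add_one]; exact hkl
        obtain ⟨m, hk1, hl1, -⟩ := (hrel _ _ (by omega) (by omega) (by omega) (by omega)).1 h1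
        obtain ⟨u, -, hu, hu'⟩ := hr ((toFin (b - 1) k : ℕ) + 1) (by omega) (by omega)
        obtain ⟨v, -, hv, hv'⟩ := hr ((toFin (b - 1) l : ℕ) + 1) (by omega) (by omega)
        rw [hu.unique hk1] at hu'
        rw [hv.unique hl1, hu'] at hv'
        have : (b : ℤ) * r ((toFin (b - 1) k : ℕ) + 1) = b * r ((toFin (b - 1) l : ℕ) + 1) := by
          linarith
        exact_mod_cast mul_left_cancel₀ (by omega) this
    have hreal : Realizes a b (lift π) ρ 0 W := by
      refine ⟨hW, fun k l h1 h2 h3 h4 => hrel k l h1 (by omega) h3 (by omega), ?_⟩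
      intro k h1 h2 h3
      rw [zero_add] at h2
      obtain ⟨m, hm, hp, hm'⟩ := hr k h1 h2
      have hp' : IsPrev W k (k - 1) := ⟨by omega, h3, fun i _ _ => by omega⟩
      rw [hp.unique hp', sub_add_cancel] at hm'
      rw [hρ k h1 h2, hm']
    exact ⟨ρ, hR, hreal.exists_all hR (by omega) (by omega) (by omega)
      (Nat.isCoprime_iff_coprime.2 hcop), hrot⟩
  · rintro ⟨ρ, h⟩
    obtain ⟨W, hW⟩ := h.exists_realizes 0
    refine ⟨⟨W, hW.walk, fun k l h1 h2 h3 h4 => hW.rel k l h1 (by omega) h3 (by omega)⟩, h.shift⟩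

/-! ### The bijection with rank sequences, and the count. -/

/-- The slack `M - ∑ i, t i` becomes an extra coordinate, giving multisets of size `M` on `d + 1`
elements. -/
theorem ncard_sum_le (d M : ℕ) :
    {t : Fin d → ℕ | ∑ i, t i ≤ M}.ncard = (M + d).choose d := by
  have e : {t : Fin d → ℕ | ∑ i, t i ≤ M} ≃ {P : Fin (d + 1) → ℕ // ∑ i, P i = M} :=
    { toFun := fun t => ⟨Fin.cons (M - ∑ i, t.1 i) t.1, by
        have := t.2
        simp only [Set.mem_ofPred_eq] at this
        rw [Fin.sum_univ_succ]
        simp only [Fin.cons_zero, Fin.cons_succ]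
        omega⟩
      invFun := fun P => ⟨Fin.tail P.1, by
        have := P.2
        rw [Fin.sum_univ_succ] at this
        simp only [Set.mem_ofPred_eq, Fin.tail]
        omega⟩
      left_inv := fun t => by simp
      right_inv := fun P => by
        apply Subtype.ext
        have := P.2
        rw [Fin.sum_univ_succ] at this
        have h0 : M - ∑ i, Fin.tail P.1 i = P.1 0 := by simp only [Fin.tail]; omega
        simp only [h0]
        exact Fin.cons_self_tail _ }
  rw [← Nat.card_coe_set_eq, Nat.card_congr (e.trans (Sym.equivNatSumOfFintype _ _).symm),
    Nat.card_eq_fintype_card, Sym.card_sym_eq_choose, Fintype.card_fin,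
    show d + 1 + M - 1 = M + d by omega, Nat.choose_symm_add]

/-- The sequence `t`, extended periodically, lists the ranks of the classes of `lift π` at their
first elements. -/
def IsRankSequence (a b d : ℕ) [NeZero (b - 1)] [NeZero d] (π : Setoid (Fin (b - 1)))
    (t : Fin d → ℕ) : Prop :=
  ∃ ρ, IsInvariant a b d (lift π) ρ ∧ ∀ k,
    (IsFirst (lift π) d k → t (toFin d k) = ρ k) ∧ (¬ IsFirst (lift π) d k → t (toFin d k) = 0)

section RankSequence

variable {a b d q : ℕ} [NeZero (b - 1)] [NeZero d]

theorem exists_isRankSequence (ha : 0 < a) (hab : a < b) (hb : 2 < b) (hcop : Nat.Coprime a b)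
    (hq : 2 ≤ q) (hqd : b - 1 = q * d) {π : Setoid (Fin (b - 1))}
    (hπ : π ∈ NC a b ∧ rot^[d] π = π) :
    ∃ t : Fin d → ℕ, q * ∑ i, t i ≤ a ∧ IsRankSequence a b d π t := by
  classical
  obtain ⟨ρ, h⟩ := (mem_NC_and_rot_iff ha hab hb hcop π).1 hπ
  have hd := NeZero.pos d
  have hbz : (b : ℤ) - 1 = q * d := by rw [← Nat.cast_mul, ← hqd]; omega
  have hdb : 2 * (d : ℤ) ≤ b - 1 := by
    rw [hbz]; gcongr; exact_mod_cast hq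
  set s : ℤ → ℕ := fun k => if IsFirst (lift π) d k then ρ k else 0 with hs
  have hs1 : ∀ k, IsFirst (lift π) d k → s k = ρ k := fun k hk => by simp [hs, hk]
  have hs0 : ∀ k, ¬ IsFirst (lift π) d k → s k = 0 := fun k hk => by simp [hs, hk]
  have hper := h.first_periodic' (by omega) (by omega) hs1 hs0
  have hst : ∀ k, s ((toFin d k : ℕ) + 1) = s k := apply_toFin hper
  refine ⟨fun i => s ((i : ℕ) + 1), ?_, ρ, h, fun k => ?_⟩
  · have h1 := h.sum_le (by omega) (by omega) (by omega) hdb hs1 hs0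
    rw [hbz, sum_Ioc_mul (by omega) hper] at h1
    have h2 := sum_toFin (n := d) fun i => s ((i : ℕ) + 1)
    simp only [hst] at h2
    rw [← h2]
    exact_mod_cast h1
  · simp only [hst]
    exact ⟨hs1 k, hs0 k⟩

theorem IsRankSequence.unique (ha : 0 < a) (hab : a < b) {π : Setoid (Fin (b - 1))}
    {t t' : Fin d → ℕ} (h : IsRankSequence a b d π t) (h' : IsRankSequence a b d π t') :
    t = t' := by
  obtain ⟨ρ, hρ, ht⟩ := h
  obtain ⟨ρ', hρ', ht'⟩ := h'
  have e : ∀ k, ρ k = ρ' k := by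
    intro k
    obtain ⟨W, hW⟩ := hρ.exists_realizes (k - 1)
    obtain ⟨W', hW'⟩ := hρ'.exists_realizes (k - 1)
    have := hW.eq_rank hW' hρ.toIsRanked hρ'.toIsRanked (by omega) (by omega)
    rwa [sub_add_cancel] at this
  funext i
  rw [← toFin_add_one i]
  by_cases hf : IsFirst (lift π) d ((i : ℕ) + 1)
  · rw [(ht _).1 hf, (ht' _).1 hf, e]
  · rw [(ht _).2 hf, (ht' _).2 hf]

theorem IsRankSequence.injective (ha : 0 < a) (hab : a < b) (hd2 : 2 * d ≤ b - 1)
    {π π' : Setoid (Fin (b - 1))} {t : Fin d → ℕ} (h : IsRankSequence a b d π t)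
    (h' : IsRankSequence a b d π' t) : π = π' := by
  obtain ⟨ρ, hρ, ht⟩ := h
  obtain ⟨ρ', hρ', ht'⟩ := h'
  have hd := NeZero.pos d
  obtain ⟨V, hV⟩ := exists_of_step fun k => (b : ℤ) * t (toFin d k) - a
  apply lift_injective
  ext k l
  rw [hρ.rel_iff_code (by omega) (by omega) (by omega) (by omega) (fun k => (ht k).1)
      (fun k => (ht k).2) hV,
    hρ'.rel_iff_code (by omega) (by omega) (by omega) (by omega) (fun k => (ht' k).1)
      (fun k => (ht' k).2) hV]

theorem exists_of_rankSequence (ha : 0 < a) (hab : a < b) (hb : 2 < b) (hcop : Nat.Coprime a b)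
    (hq : 2 ≤ q) (hqd : b - 1 = q * d) {t : Fin d → ℕ} (hsum : q * ∑ i, t i ≤ a) :
    ∃ π : Setoid (Fin (b - 1)), (π ∈ NC a b ∧ rot^[d] π = π) ∧ IsRankSequence a b d π t := by
  have hd := NeZero.pos d
  have hbz : (b : ℤ) - 1 = q * d := by rw [← Nat.cast_mul, ← hqd]; omega
  have hdb : 2 * (d : ℤ) ≤ b - 1 := by
    rw [hbz]; gcongr; exact_mod_cast hq
  have hsd : Function.Periodic (fun k => t (toFin d k)) (d : ℤ) := fun k => by
    simp only [toFin_periodic k]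
  obtain ⟨V, hV⟩ := exists_of_step fun k => (b : ℤ) * t (toFin d k) - a
  -- The deficit `a - q * ∑ i, t i` plays the role of `z`, the rank of the central class.
  have hS : (∑ k ∈ Finset.Ioc 0 ((b : ℤ) - 1), t (toFin d k) : ℕ) +
      ((a - q * ∑ i, t i : ℕ) : ℤ) = a := by
    rw [hbz, sum_Ioc_mul (s := fun k => t (toFin d k)) (by omega) hsd, sum_toFin]
    omega
  have hinv := isInvariant_code (a := a) (b := b) (d := d) (by omega) (by omega)
    (Nat.isCoprime_iff_coprime.2 hcop) (by omega) hq hbz hsd hV hS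
  have hfirst := isFirst_code (a := a) (b := b) (d := d) (z := a - q * ∑ i, t i) (by omega)
    (by omega) (by omega) hdb hsd hV
  set R := codeSetoid V ((b : ℤ) - 1)
  set ρ := codeRank V (fun k => t (toFin d k)) (a - q * ∑ i, t i)
  have hlift : lift (Setoid.comap (fun i : Fin (b - 1) => ((i : ℕ) : ℤ) + 1) R) = R := by
    have key : ∀ x, R ((toFin (b - 1) x : ℕ) + 1) x := by
      intro x
      have h1 := hinv.periodic_mul ((toFin (b - 1) x : ℕ) + 1) ((x - 1) / (b - 1 : ℕ))
      have h2 := eq_toFin_add (n := b - 1) x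
      rw [show ((b - 1 : ℕ) : ℤ) = b - 1 by omega] at h1 h2
      rwa [← h2] at h1
    ext x y
    change R ((toFin (b - 1) x : ℕ) + 1) ((toFin (b - 1) y : ℕ) + 1) ↔ R x y
    exact ⟨fun h => R.trans (R.trans (R.symm (key x)) h) (key y),
      fun h => R.trans (R.trans (key x) h) (R.symm (key y))⟩
  refine ⟨Setoid.comap (fun i : Fin (b - 1) => ((i : ℕ) : ℤ) + 1) R,
    (mem_NC_and_rot_iff ha hab hb hcop _).2 ⟨ρ, by rwa [hlift]⟩, ρ, by rwa [hlift], ?_⟩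
  rw [hlift]
  exact hfirst

end RankSequence
end RationalNC

theorem mainTheorem11 (a b d : ℕ) (ha : 0 < a) (hab : a < b) (hcop : Nat.Coprime a b)
    (hd : 1 ≤ d) (hdvd : d ∣ b - 1) (hlt : d < b - 1) :
    {π : Setoid (Fin (b - 1)) | π ∈ RationalNC.NC a b ∧ RationalNC.rot^[d] π = π}.ncard =
      Nat.choose (a * d / (b - 1) + d) d := by
  obtain ⟨q, hq⟩ := hdvd
  rw [mul_comm] at hq
  have hq2 : 2 ≤ q := by
    by_contra! h
    have : q * d ≤ 1 * d := Nat.mul_le_mul_right d (by omega)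
    omega
  have hd2 : 2 * d ≤ b - 1 := by rw [hq]; exact Nat.mul_le_mul_right d hq2
  have : NeZero (b - 1) := ⟨by omega⟩
  have : NeZero d := ⟨by omega⟩
  have hb : 2 < b := by omega
  have hdiv : a * d / (b - 1) = a / q := by rw [hq, Nat.mul_div_mul_right _ _ hd]
  rw [hdiv, ← RationalNC.ncard_sum_le]
  have hmem : ∀ t : Fin d → ℕ, t ∈ {t : Fin d → ℕ | ∑ i, t i ≤ a / q} ↔ q * ∑ i, t i ≤ a := by
    intro t
    rw [Set.mem_ofPred_eq, Nat.le_div_iff_mul_le (by omega), mul_comm]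
  have hex : ∀ π ∈ {π : Setoid (Fin (b - 1)) | π ∈ RationalNC.NC a b ∧ RationalNC.rot^[d] π = π},
      ∃ t : Fin d → ℕ, q * ∑ i, t i ≤ a ∧ RationalNC.IsRankSequence a b d π t :=
    fun π hπ => RationalNC.exists_isRankSequence ha hab hb hcop hq2 hq hπ
  choose f hf hf' using hex
  refine Set.ncard_congr f (fun π hπ => (hmem _).2 (hf π hπ)) (fun π π' hπ hπ' h => ?_)
    fun t ht => ?_
  · have h1 := hf' π hπ
    rw [h] at h1
    exact h1.injective ha hab hd2 (hf' π' hπ')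
  · obtain ⟨π, hπ, hπt⟩ := RationalNC.exists_of_rankSequence ha hab hb hcop hq2 hq ((hmem t).1 ht)
    exact ⟨π, hπ, (hf' π hπ).unique ha hab hπt⟩
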